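/- Let $\mathbb K\in\{\mathbb R,\mathbb C\}$ and let $\mathbb P$ be the cone of positive definite (selfadjoint) matrices of a fixed finite size over $\mathbb K$. For $X,Y\in\mathbb P$ let $$\delta(X,Y)=\inf_\gamma\int_a^b\bigl\|\gamma(t)^{-1/2}\gamma'(t)\gamma(t)^{-1/2}\bigr\|_2\,dt ,$$ the infimum being over all piecewise smooth paths $\gamma:[a,b]\to\mathbb P$ from $X$ to $Y$, where $\|\cdot\|_2$ is the Frobenius norm, and let $X\#_tY=X^{1/2}(X^{-1/2}YX^{-1/2})^tX^{1/2}$ for $t\in[0,1]$. The inductive means of a sequence $B=(B_1,B_2,\dots)$ in $\mathbb P$ are $S_1(B)=B_1$ and $S_n(B)=S_{n-1}(B)\#_{1/n}B_n$ for $n\ge 2$. Let $m\ge 1$ and $A_0,\dots,A_{m-1}\in\mathbb P$. Then the function $C\mapsto\sum_{j=0}^{m-1}\delta^2(A_j,C)$ on $\mathbb P$ has a unique minimizer $G$ (the least squares, or Karcher, mean of $A_0,\dots,A_{m-1}$). For a sequence $\sigma=(\sigma_j)_{j\ge1}$ of permutations of $\{0,\dots,m-1\}$ put $$A_\sigma=(A_{\sigma_1(0)},\dots,A_{\sigma_1(m-1)},A_{\sigma_2(0)},\dots,A_{\sigma_2(m-1)},\dots).$$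 Then: 1. There is $L>0$, depending only on $A_0,\dots,A_{m-1}$, such that for every $\sigma$ and every $n\ge1$, $$\delta^2(S_n(A_\sigma),G)\le \frac Ln .$$ 2. For every $\sigma$, $\lim_{n\to\infty}S_n(A_\sigma)=G$ (in the usual topology of matrices). 3. For every $\sigma$ and every $k\ge1$, $$\delta^2(S_{km}(A_\sigma),G)\le\frac{\alpha+3\Delta^2}{k},\qquad \alpha=\frac1m\sum_{i=0}^{m-1}\delta^2(G,A_i),\quad \Delta=\max_{0\le i,j\le m-1}\delta(A_i,A_j).$$ -/

import Mathlib

/-! The cone of positive definite matrices over `𝕜 = ℝ` or `ℂ` with its trace Riemannian metric,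
least squares means and inductive means. -/

noncomputable section

namespace LSMean

open scoped ContDiff ComplexOrder Matrix.Norms.Frobenius

variable {𝕜 : Type*} [RCLike 𝕜] {ι : Type*} [Fintype ι] [DecidableEq ι]

/-- The real power `M ^ t` of a positive definite matrix, by functional calculus. -/
def mpow (M : Matrix ι ι 𝕜) (t : ℝ) : Matrix ι ι 𝕜 :=
  cfc (fun x : ℝ => x ^ t) M

/-- `α` restricts to a piecewise smooth path `[a, b] → {positive definite matrices}`: there is a
partition `a = t₀ < t₁ < ⋯ < t_k = b` such that (every entry of) `α` is `C^∞` on each closed piece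
`[t_l, t_{l+1}]` (in particular `α` is continuous on `[a, b]`). -/
def IsPiecewiseSmoothPath (α : ℝ → Matrix ι ι 𝕜) (a b : ℝ) : Prop :=
  a < b ∧ (∀ s ∈ Set.Icc a b, (α s).PosDef) ∧
    ∃ (k : ℕ) (t : Fin (k + 1) → ℝ), StrictMono t ∧ t 0 = a ∧ t (Fin.last k) = b ∧
      ∀ (l : Fin k) (i j : ι),
        ContDiffOn ℝ ∞ (fun s => α s i j) (Set.Icc (t l.castSucc) (t l.succ))

/-- The derivative `α'(s)` of a matrix-valued path, entry by entry. -/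
def velocity (α : ℝ → Matrix ι ι 𝕜) (s : ℝ) : Matrix ι ι 𝕜 :=
  Matrix.of fun i j => deriv (fun u => α u i j) s

/-- The length `∫_a^b ‖α(s)^{-1/2} α'(s) α(s)^{-1/2}‖₂ ds`, with the Frobenius norm. For a piecewise
smooth path `velocity α s` is the derivative of the path except at the finitely many points of the
partition, which do not contribute to the integral. -/
def pathLength (α : ℝ → Matrix ι ι 𝕜) (a b : ℝ) : ℝ :=
  ∫ s in a..b, ‖mpow (α s) (-1 / 2) * velocity α s * mpow (α s) (-1 / 2)‖

/-- The trace Riemannian distance between positive definite matrices: the infimum of the lengths of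
the piecewise smooth paths from `A` to `B` in the positive definite cone. -/
def rdist (A B : Matrix ι ι 𝕜) : ℝ :=
  sInf {l : ℝ | ∃ (α : ℝ → Matrix ι ι 𝕜) (a b : ℝ),
    IsPiecewiseSmoothPath α a b ∧ α a = A ∧ α b = B ∧ l = pathLength α a b}

/-- The point `A #_t B = A^{1/2} (A^{-1/2} B A^{-1/2})^t A^{1/2}` of the geodesic from `A` to `B`. -/
def geodesic (A B : Matrix ι ι 𝕜) (t : ℝ) : Matrix ι ι 𝕜 :=
  mpow A (1 / 2) * mpow (mpow A (-1 / 2) * B * mpow A (-1 / 2)) t * mpow A (1 / 2)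

/-- `G` is a least squares mean of `A₀, …, A_{m-1}`: it minimizes `C ↦ ∑ δ²(A_j, C)` over the
positive definite matrices. -/
def IsLeastSquaresMean {m : ℕ} (A : Fin m → Matrix ι ι 𝕜) (G : Matrix ι ι 𝕜) : Prop :=
  G.PosDef ∧ ∀ C : Matrix ι ι 𝕜, C.PosDef →
    ∑ j, rdist (A j) G ^ 2 ≤ ∑ j, rdist (A j) C ^ 2

/-- The inductive means of a sequence `a 0, a 1, a 2, …`: `S_n` is the inductive mean of the first
`n` terms `a 0, …, a (n - 1)`, so `S_1 = a 0` and `S_{n+1} = S_n #_{1/(n+1)} (a n)` for `n ≥ 1`.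
The value at `n = 0` is a dummy. -/
def inductiveMean (a : ℕ → Matrix ι ι 𝕜) : ℕ → Matrix ι ι 𝕜
  | 0 => a 0
  | 1 => a 0
  | n + 2 => geodesic (inductiveMean a (n + 1)) (a (n + 1)) (1 / ((n : ℝ) + 2))

/-- The concatenation of the blocks `(A_{σ_j(0)}, …, A_{σ_j(m-1)})`, `j = 0, 1, 2, …`. -/
def blockSeq {m : ℕ} [NeZero m] (A : Fin m → Matrix ι ι 𝕜) (σ : ℕ → Equiv.Perm (Fin m)) :
    ℕ → Matrix ι ι 𝕜 :=
  fun i => A (σ (i / m) (Fin.ofNat m i))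

/-- The diameter `Δ = max_{i,j} δ(A_i, A_j)`. -/
def diam {m : ℕ} (A : Fin m → Matrix ι ι 𝕜) : ℝ :=
  ⨆ p : Fin m × Fin m, rdist (A p.1) (A p.2)

/-- The mean square distance `(1/m) ∑ δ²(G, A_i)`. -/
def meanSqDist {m : ℕ} (A : Fin m → Matrix ι ι 𝕜) (G : Matrix ι ι 𝕜) : ℝ :=
  (1 / (m : ℝ)) * ∑ i, rdist G (A i) ^ 2

end LSMean

end

set_option linter.unusedSectionVars false

noncomputable section

namespace LSMean

open scoped ContDiff ComplexOrder Matrix.Norms.Frobenius Matrix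

variable {𝕜 : Type*} [RCLike 𝕜] {ι : Type*} [Fintype ι] [DecidableEq ι]

/-! ### The Frobenius norm and the trace pairing -/

/-! The cone with the trace metric is a complete space of nonpositive curvature, and only two
consequences of this are used: the closed form δ(A,B) = ‖log(A^{-1/2} B A^{-1/2})‖
(`rdist_eq_logDist`) and the semiparallelogram law along geodesics (`logDist_geodesic_sq_le`).

For the closed form, ‖log Y‖² is a trace function, so its derivative comes from scalar Taylor bounds
weighted by overlaps of eigenbases. Cauchy–Schwarz then shows that the distance to a fixed point
grows along a path no faster than its length, and the geodesic attains equality.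

For the semiparallelogram law, congruence reduces the claim to convexity of s ↦ ‖log(M^{-s/2} Z
M^{-s/2})‖² - s²‖log M‖². Monotonicity of the derivative is the infinitesimal limit of a finite
inequality (`two_mul_norm_sub_inv_sq_le`), which holds entrywise because the logarithmic mean is at
most the arithmetic mean.

The law yields the variance inequality Σδ²(A_i,G) + mδ²(G,C) ≤ Σδ²(A_i,C), hence uniqueness of G;
existence is compactness of balls. For the walk it gives (n+1)δ²(S_{n+1},G) ≤ nδ²(S_n,G) + δ²(a_n,G)
- n/(n+1) δ²(S_n,a_n). During a block starting at N = km the walk drifts from S_N by at most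
jΔ/(N+1) in j steps, so S_n can be replaced by S_N in the last term at small cost. A block meets
every A_i once, whatever the permutation, so the variance inequality applies to its sum. With D_k =
δ²(S_{km},G) this becomes (k+1)D_{k+1} ≤ (k-1)D_k + Δ²/k (`IsBlockWalk.succ_block`); multiplied by k
it telescopes, giving D_k ≤ Δ²/k for k ≥ 2, while D_1 ≤ α. The drift bound covers the indices inside
a block. -/

theorem frobenius_norm_sq (X : Matrix ι ι 𝕜) : ‖X‖ ^ 2 = ∑ i, ∑ j, ‖X i j‖ ^ 2 := by
  rw [Matrix.frobenius_norm_def, ← Real.sqrt_eq_rpow, Real.sq_sqrt (by positivity)]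
  simp

theorem re_trace_conjTranspose_mul (X Y : Matrix ι ι 𝕜) :
    RCLike.re (Xᴴ * Y).trace = ∑ j, ∑ i, RCLike.re (star (X i j) * Y i j) := by
  simp [Matrix.trace, Matrix.mul_apply]

theorem re_trace_conjTranspose_mul_self (X : Matrix ι ι 𝕜) :
    RCLike.re (Xᴴ * X).trace = ‖X‖ ^ 2 := by
  rw [re_trace_conjTranspose_mul, frobenius_norm_sq, Finset.sum_comm]
  refine Finset.sum_congr rfl fun i _ => Finset.sum_congr rfl fun j _ => ?_
  rw [RCLike.star_def, RCLike.conj_mul]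
  exact_mod_cast RCLike.ofReal_re (K := 𝕜) _

theorem _root_.Matrix.IsHermitian.re_trace_mul_self {X : Matrix ι ι 𝕜} (hX : X.IsHermitian) :
    RCLike.re (X * X).trace = ‖X‖ ^ 2 := by
  rw [← re_trace_conjTranspose_mul_self, hX.eq]

theorem abs_re_trace_conjTranspose_mul_le (X Y : Matrix ι ι 𝕜) :
    |RCLike.re (Xᴴ * Y).trace| ≤ ‖X‖ * ‖Y‖ := by
  rw [re_trace_conjTranspose_mul]
  have h1 : |∑ j, ∑ i, RCLike.re (star (X i j) * Y i j)| ≤ ∑ j, ∑ i, ‖X i j‖ * ‖Y i j‖ := by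
    refine (Finset.abs_sum_le_sum_abs _ _).trans (Finset.sum_le_sum fun j _ => ?_)
    refine (Finset.abs_sum_le_sum_abs _ _).trans (Finset.sum_le_sum fun i _ => ?_)
    refine (RCLike.abs_re_le_norm _).trans ?_
    simp
  refine h1.trans ?_
  rw [← Finset.univ.sum_product' Finset.univ (fun j i => ‖X i j‖ * ‖Y i j‖)]
  refine abs_le_of_sq_le_sq' ?_ (by positivity) |>.2
  refine (Finset.sum_mul_sq_le_sq_mul_sq _ _ _).trans (le_of_eq ?_)
  rw [mul_pow, frobenius_norm_sq, frobenius_norm_sq, Finset.sum_product_right,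
    Finset.sum_product_right]

theorem abs_re_trace_mul_le {X : Matrix ι ι 𝕜} (hX : X.IsHermitian) (Y : Matrix ι ι 𝕜) :
    |RCLike.re (X * Y).trace| ≤ ‖X‖ * ‖Y‖ := by
  simpa [hX.eq] using abs_re_trace_conjTranspose_mul_le X Y

/-! ### Functional calculus of Hermitian matrices -/

section

variable {X : Matrix ι ι 𝕜}

theorem cfc_eq_mul_diagonal_mul (hX : X.IsHermitian) (f : ℝ → ℝ) :
    cfc f X = (hX.eigenvectorUnitary : Matrix ι ι 𝕜) *
      Matrix.diagonal (fun i => (f (hX.eigenvalues i) : 𝕜)) *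
      (hX.eigenvectorUnitary : Matrix ι ι 𝕜)ᴴ := by
  rw [hX.cfc_eq, Matrix.IsHermitian.cfc, Unitary.conjStarAlgAut_apply]
  rfl

theorem conjTranspose_eigenvectorUnitary_mul (hX : X.IsHermitian) :
    (hX.eigenvectorUnitary : Matrix ι ι 𝕜)ᴴ * (hX.eigenvectorUnitary : Matrix ι ι 𝕜) = 1 :=
  Unitary.coe_star_mul_self _

theorem eigenvectorUnitary_mul_conjTranspose (hX : X.IsHermitian) :
    (hX.eigenvectorUnitary : Matrix ι ι 𝕜) * (hX.eigenvectorUnitary : Matrix ι ι 𝕜)ᴴ = 1 :=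
  Unitary.coe_mul_star_self _

theorem isHermitian_cfc (f : ℝ → ℝ) : (cfc f X).IsHermitian := by
  have : IsSelfAdjoint (cfc f X) := cfc_predicate f X
  exact this

theorem continuousOn_spectrum (f : ℝ → ℝ) : ContinuousOn f (spectrum ℝ X) :=
  Matrix.finite_real_spectrum.continuousOn f

theorem cfc_mul_cfc (f g : ℝ → ℝ) : cfc f X * cfc g X = cfc (fun x => f x * g x) X :=
  (cfc_mul f g X (continuousOn_spectrum f) (continuousOn_spectrum g)).symm

theorem cfc_sub_cfc (f g : ℝ → ℝ) : cfc f X - cfc g X = cfc (fun x => f x - g x) X :=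
  (cfc_sub f g X (continuousOn_spectrum f) (continuousOn_spectrum g)).symm

theorem smul_cfc (c : ℝ) (f : ℝ → ℝ) : c • cfc f X = cfc (fun x => c * f x) X :=
  (cfc_smul c f X (continuousOn_spectrum f)).symm

theorem cfc_one_fun (hX : X.IsHermitian) : cfc (fun _ : ℝ => (1 : ℝ)) X = 1 := cfc_const_one ℝ X hX

theorem cfc_id_fun (hX : X.IsHermitian) : cfc (fun x : ℝ => x) X = X := cfc_id' ℝ X hX

theorem cfc_cfc (hX : X.IsHermitian) (f g : ℝ → ℝ) : cfc g (cfc f X) = cfc (fun x => g (f x)) X :=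
  (cfc_comp' g f X ((Matrix.finite_real_spectrum.image f).continuousOn g)
    (continuousOn_spectrum f) hX).symm

theorem cfc_congr_eigenvalues (hX : X.IsHermitian) {f g : ℝ → ℝ}
    (h : ∀ i, f (hX.eigenvalues i) = g (hX.eigenvalues i)) : cfc f X = cfc g X := by
  apply cfc_congr
  rw [hX.spectrum_real_eq_range_eigenvalues]
  rintro _ ⟨i, rfl⟩
  exact h i

theorem re_trace_cfc (hX : X.IsHermitian) (f : ℝ → ℝ) :
    RCLike.re (cfc f X).trace = ∑ i, f (hX.eigenvalues i) := by
  rw [cfc_eq_mul_diagonal_mul hX, Matrix.trace_mul_cycle, conjTranspose_eigenvectorUnitary_mul,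
    Matrix.one_mul, Matrix.trace_diagonal]
  simp

theorem norm_cfc_sq (hX : X.IsHermitian) (f : ℝ → ℝ) : ‖cfc f X‖ ^ 2 = ∑ i, f (hX.eigenvalues i) ^ 2 := by
  rw [← (isHermitian_cfc f).re_trace_mul_self, cfc_mul_cfc, re_trace_cfc hX]
  simp [sq]

end

/-- The weights `|⟨u_i, v_j⟩|²` of two orthonormal eigenbases. -/
def overlap {X Y : Matrix ι ι 𝕜} (hX : X.IsHermitian) (hY : Y.IsHermitian) (i j : ι) : ℝ :=
  ‖((hX.eigenvectorUnitary : Matrix ι ι 𝕜)ᴴ * (hY.eigenvectorUnitary : Matrix ι ι 𝕜)) i j‖ ^ 2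

theorem overlap_nonneg {X Y : Matrix ι ι 𝕜} (hX : X.IsHermitian) (hY : Y.IsHermitian) (i j : ι) :
    0 ≤ overlap hX hY i j := by
  unfold overlap; positivity

theorem re_trace_diagonal_mul_mul_diagonal_mul (W : Matrix ι ι 𝕜) (f g : ι → ℝ) :
    RCLike.re (Matrix.diagonal (fun i => (f i : 𝕜)) * W * Matrix.diagonal (fun i => (g i : 𝕜)) *
      Wᴴ).trace = ∑ i, ∑ j, f i * g j * ‖W i j‖ ^ 2 := by
  rw [Matrix.trace, map_sum]
  refine Finset.sum_congr rfl fun i _ => ?_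
  rw [Matrix.diag_apply, Matrix.mul_apply, map_sum]
  refine Finset.sum_congr rfl fun j _ => ?_
  rw [Matrix.mul_diagonal, Matrix.diagonal_mul, Matrix.conjTranspose_apply]
  have : (f i : 𝕜) * W i j * (g j : 𝕜) * star (W i j) =
      ((f i * g j * ‖W i j‖ ^ 2 : ℝ) : 𝕜) := by
    push_cast
    rw [← RCLike.mul_conj, RCLike.star_def]
    ring
  rw [this, RCLike.ofReal_re]

/-- Trace expressions in two noncommuting matrices become double sums with nonnegative weights, so
scalar inequalities can be applied term by term. -/
theorem re_trace_cfc_mul_cfc {X Y : Matrix ι ι 𝕜} (hX : X.IsHermitian) (hY : Y.IsHermitian)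
    (f g : ℝ → ℝ) : RCLike.re (cfc f X * cfc g Y).trace =
      ∑ i, ∑ j, f (hX.eigenvalues i) * g (hY.eigenvalues j) * overlap hX hY i j := by
  unfold overlap
  rw [← re_trace_diagonal_mul_mul_diagonal_mul
      ((hX.eigenvectorUnitary : Matrix ι ι 𝕜)ᴴ * (hY.eigenvectorUnitary : Matrix ι ι 𝕜))
      (fun i => f (hX.eigenvalues i)) (fun i => g (hY.eigenvalues i)),
    cfc_eq_mul_diagonal_mul hX, cfc_eq_mul_diagonal_mul hY]
  congr 1
  rw [Matrix.conjTranspose_mul, Matrix.conjTranspose_conjTranspose, Matrix.mul_assoc,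
    Matrix.mul_assoc, Matrix.trace_mul_comm]
  simp only [Matrix.mul_assoc]

theorem sum_overlap {X Y : Matrix ι ι 𝕜} (hX : X.IsHermitian) (hY : Y.IsHermitian) (j : ι) :
    ∑ i, overlap hX hY i j = 1 := by
  unfold overlap
  set U := (hX.eigenvectorUnitary : Matrix ι ι 𝕜) with hU
  set V := (hY.eigenvectorUnitary : Matrix ι ι 𝕜) with hV
  have h : (Uᴴ * V)ᴴ * (Uᴴ * V) = 1 := by
    rw [Matrix.conjTranspose_mul, Matrix.conjTranspose_conjTranspose, Matrix.mul_assoc,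
      ← Matrix.mul_assoc U, hU, eigenvectorUnitary_mul_conjTranspose hX, Matrix.one_mul, hV,
      conjTranspose_eigenvectorUnitary_mul hY]
  have h2 := congrFun (congrFun h j) j
  rw [Matrix.mul_apply, Matrix.one_apply_eq] at h2
  have h3 : ((∑ i, ‖(Uᴴ * V) i j‖ ^ 2 : ℝ) : 𝕜) = 1 := by
    rw [← h2]
    push_cast
    refine Finset.sum_congr rfl fun i _ => ?_
    rw [Matrix.conjTranspose_apply, ← RCLike.conj_mul, RCLike.star_def]
  exact_mod_cast h3

theorem norm_sub_sq_eq_overlap {X Y : Matrix ι ι 𝕜} (hX : X.IsHermitian) (hY : Y.IsHermitian) :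
    ‖Y - X‖ ^ 2 =
      ∑ i, ∑ j, (hY.eigenvalues j - hX.eigenvalues i) ^ 2 * overlap hX hY i j := by
  rw [← (hY.sub hX).re_trace_mul_self]
  have e : (Y - X) * (Y - X) = Y * Y - Y * X - X * Y + X * X := by noncomm_ring
  have e1 : RCLike.re (Y * Y).trace = RCLike.re (cfc (fun _ : ℝ => (1 : ℝ)) X *
      cfc (fun x : ℝ => x * x) Y).trace := by
    rw [cfc_one_fun hX, ← cfc_mul_cfc, cfc_id_fun hY, Matrix.one_mul]
  have e2 : RCLike.re (X * X).trace = RCLike.re (cfc (fun x : ℝ => x * x) X *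
      cfc (fun _ : ℝ => (1 : ℝ)) Y).trace := by
    rw [cfc_one_fun hY, ← cfc_mul_cfc, cfc_id_fun hX, Matrix.mul_one]
  have e3 : RCLike.re (X * Y).trace = RCLike.re (cfc (fun x : ℝ => x) X *
      cfc (fun x : ℝ => x) Y).trace := by
    rw [cfc_id_fun hX, cfc_id_fun hY]
  rw [e, Matrix.trace_add, Matrix.trace_sub, Matrix.trace_sub, Matrix.trace_mul_comm Y X]
  simp only [map_add, map_sub]
  rw [e1, e2, e3, re_trace_cfc_mul_cfc hX hY, re_trace_cfc_mul_cfc hX hY,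
    re_trace_cfc_mul_cfc hX hY]
  simp only [← Finset.sum_add_distrib, ← Finset.sum_sub_distrib]
  refine Finset.sum_congr rfl fun i _ => Finset.sum_congr rfl fun j _ => ?_
  ring

/-- For fixed j the overlaps are probability weights, and ‖Y - X‖² is at least the corresponding
average of the squared gaps. -/
theorem exists_eigenvalue_near {X Y : Matrix ι ι 𝕜} (hX : X.IsHermitian) (hY : Y.IsHermitian)
    (j : ι) : ∃ i, |hY.eigenvalues j - hX.eigenvalues i| ≤ ‖Y - X‖ := by
  by_contra! h
  have h1 : ∀ i, ‖Y - X‖ ^ 2 < (hY.eigenvalues j - hX.eigenvalues i) ^ 2 := fun i => by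
    rw [← sq_abs (_ - _)]
    exact pow_lt_pow_left₀ (h i) (norm_nonneg _) two_ne_zero
  obtain ⟨i0, -, hi0⟩ : ∃ i ∈ Finset.univ, 0 < overlap hX hY i j := by
    by_contra! h0
    have := Finset.sum_nonpos h0
    rw [sum_overlap] at this
    linarith
  have h2 : ‖Y - X‖ ^ 2 <
      ∑ i, (hY.eigenvalues j - hX.eigenvalues i) ^ 2 * overlap hX hY i j := by
    calc ‖Y - X‖ ^ 2 = ∑ i, ‖Y - X‖ ^ 2 * overlap hX hY i j := by
          rw [← Finset.mul_sum, sum_overlap, mul_one]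
      _ < _ := Finset.sum_lt_sum
          (fun i _ => mul_le_mul_of_nonneg_right (h1 i).le (overlap_nonneg ..))
          ⟨i0, Finset.mem_univ _, mul_lt_mul_of_pos_right (h1 i0) hi0⟩
  have h3 := norm_sub_sq_eq_overlap hX hY
  rw [Finset.sum_comm] at h3
  have h4 := Finset.single_le_sum (f := fun j => ∑ i, (hY.eigenvalues j - hX.eigenvalues i) ^ 2 *
    overlap hX hY i j) (fun j _ => Finset.sum_nonneg fun i _ =>
      mul_nonneg (sq_nonneg _) (overlap_nonneg hX hY i j)) (Finset.mem_univ j)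
  linarith

/-! ### Powers and logarithms of positive definite matrices -/

/-- The logarithm of a positive definite matrix, by functional calculus. -/
def mlog (M : Matrix ι ι 𝕜) : Matrix ι ι 𝕜 := cfc Real.log M

theorem isHermitian_mpow (M : Matrix ι ι 𝕜) (t : ℝ) : (mpow M t).IsHermitian :=
  isHermitian_cfc _

theorem isHermitian_mlog (M : Matrix ι ι 𝕜) : (mlog M).IsHermitian :=
  isHermitian_cfc _

theorem posDef_cfc {M : Matrix ι ι 𝕜} (hM : M.IsHermitian) {f : ℝ → ℝ}
    (hf : ∀ i, 0 < f (hM.eigenvalues i)) : (cfc f M).PosDef := by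
  rw [cfc_eq_mul_diagonal_mul hM, ← Matrix.star_eq_conjTranspose,
    Matrix.IsUnit.posDef_star_right_conjugate_iff
      (IsUnit.of_mul_eq_one _ (eigenvectorUnitary_mul_conjTranspose hM))]
  refine Matrix.PosDef.diagonal fun i => ?_
  exact_mod_cast hf i

section

variable {M : Matrix ι ι 𝕜}

theorem posDef_mpow (hM : M.PosDef) (t : ℝ) : (mpow M t).PosDef :=
  posDef_cfc hM.1 fun i => Real.rpow_pos_of_pos (hM.eigenvalues_pos i) t

theorem mpow_mul_mpow (hM : M.PosDef) (s t : ℝ) : mpow M s * mpow M t = mpow M (s + t) := by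
  rw [mpow, mpow, mpow, cfc_mul_cfc]
  exact cfc_congr_eigenvalues hM.1 fun i => (Real.rpow_add (hM.eigenvalues_pos i) s t).symm

theorem mpow_zero (hM : M.PosDef) : mpow M 0 = 1 := by
  simp only [mpow, Real.rpow_zero]
  exact cfc_one_fun hM.1

theorem mpow_one (hM : M.PosDef) : mpow M 1 = M := by
  simp only [mpow, Real.rpow_one]
  exact cfc_id_fun hM.1

theorem mpow_mpow (hM : M.PosDef) (s t : ℝ) : mpow (mpow M s) t = mpow M (s * t) := by
  rw [mpow, mpow, mpow, cfc_cfc hM.1]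
  exact cfc_congr_eigenvalues hM.1 fun i => (Real.rpow_mul (hM.eigenvalues_pos i).le s t).symm

theorem mpow_mul_mpow_neg (hM : M.PosDef) (t : ℝ) : mpow M t * mpow M (-t) = 1 := by
  rw [mpow_mul_mpow hM, add_neg_cancel, mpow_zero hM]

theorem mpow_neg_mul_mpow (hM : M.PosDef) (t : ℝ) : mpow M (-t) * mpow M t = 1 := by
  rw [mpow_mul_mpow hM, neg_add_cancel, mpow_zero hM]

theorem inv_mpow (hM : M.PosDef) (t : ℝ) : (mpow M t)⁻¹ = mpow M (-t) :=
  Matrix.inv_eq_right_inv (mpow_mul_mpow_neg hM t)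

theorem mpow_half_mul_mpow_half (hM : M.PosDef) : mpow M (1 / 2) * mpow M (1 / 2) = M := by
  rw [mpow_mul_mpow hM, add_halves, mpow_one hM]

theorem mpow_neg_half_mul_mpow_neg_half (hM : M.PosDef) :
    mpow M (-1 / 2) * mpow M (-1 / 2) = M⁻¹ := by
  rw [mpow_mul_mpow hM, add_halves, ← inv_mpow hM, mpow_one hM]

theorem mpow_half_mul_mpow_neg_half (hM : M.PosDef) :
    mpow M (1 / 2) * mpow M (-1 / 2) = 1 := by
  rw [neg_div, mpow_mul_mpow_neg hM]

theorem mpow_neg_half_mul_mpow_half (hM : M.PosDef) :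
    mpow M (-1 / 2) * mpow M (1 / 2) = 1 := by
  rw [neg_div, mpow_neg_mul_mpow hM]

theorem mlog_mpow (hM : M.PosDef) (t : ℝ) : mlog (mpow M t) = t • mlog M := by
  rw [mlog, mpow, cfc_cfc hM.1, mlog, smul_cfc]
  exact cfc_congr_eigenvalues hM.1 fun i => Real.log_rpow (hM.eigenvalues_pos i) t

theorem mlog_mul_mpow_comm (t : ℝ) : mlog M * mpow M t = mpow M t * mlog M := by
  rw [mlog, mpow, cfc_mul_cfc, cfc_mul_cfc]
  simp only [mul_comm]

theorem mpow_eq_cfc_mlog (hM : M.PosDef) (t : ℝ) :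
    mpow M t = cfc (fun x => Real.exp (t * x)) (mlog M) := by
  rw [mlog, mpow, cfc_cfc hM.1]
  refine cfc_congr_eigenvalues hM.1 fun i => ?_
  rw [Real.rpow_def_of_pos (hM.eigenvalues_pos i), mul_comm]

theorem eq_one_of_mlog_eq_zero (hM : M.PosDef) (h : mlog M = 0) : M = 1 := by
  have h1 := mpow_eq_cfc_mlog hM 1
  rw [mpow_one hM, h] at h1
  rw [h1, ← cfc_one_fun (X := (0 : Matrix ι ι 𝕜)) Matrix.isHermitian_zero]
  refine cfc_congr fun x hx => ?_
  have : x = 0 := by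
    cases isEmpty_or_nonempty ι
    · rw [Matrix.isHermitian_zero.spectrum_real_eq_range_eigenvalues] at hx
      simp at hx
    · rw [spectrum.zero_eq] at hx
      exact hx
  simp [this]

/-- The spectral projections do not depend on f; hence t ↦ `mpow M t` can be differentiated
coefficient by coefficient. -/
theorem cfc_eq_sum_smul {X : Matrix ι ι 𝕜} (hX : X.IsHermitian) (f : ℝ → ℝ) :
    cfc f X = ∑ i, f (hX.eigenvalues i) • ((hX.eigenvectorUnitary : Matrix ι ι 𝕜) *
      Matrix.single i i 1 * (hX.eigenvectorUnitary : Matrix ι ι 𝕜)ᴴ) := by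
  rw [cfc_eq_mul_diagonal_mul hX, ← Matrix.sum_single_eq_diagonal, Finset.mul_sum, Finset.sum_mul]
  refine Finset.sum_congr rfl fun i _ => ?_
  rw [← Matrix.smul_mul, ← Matrix.mul_smul]
  congr 2
  rw [Matrix.smul_single, RCLike.real_smul_eq_coe_mul, mul_one]

theorem hasDerivAt_mpow (hM : M.PosDef) (t : ℝ) :
    HasDerivAt (fun t => mpow M t) (mlog M * mpow M t) t := by
  have h : (fun t => mpow M t) = fun t => ∑ i, (hM.1.eigenvalues i ^ t) •
      ((hM.1.eigenvectorUnitary : Matrix ι ι 𝕜) *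
      Matrix.single i i 1 * (hM.1.eigenvectorUnitary : Matrix ι ι 𝕜)ᴴ) :=
    funext fun t => cfc_eq_sum_smul hM.1 _
  rw [h, mlog, mpow, cfc_mul_cfc, cfc_eq_sum_smul hM.1]
  refine HasDerivAt.fun_sum fun i _ => HasDerivAt.smul_const ?_ _
  have := (hasDerivAt_id t).const_rpow (hM.eigenvalues_pos i)
  simpa using this

end

/-! ### Differentiability of `X ↦ ‖log X‖²` -/

/-- With u = y/x everything follows from 1 - 1/u ≤ log u ≤ u - 1, and 1/u ≤ x/ε keeps the constant
independent of y. -/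
theorem abs_log_sq_sub_le {x y ε : ℝ} (hx : 0 < x) (hε : 0 < ε) (hy : ε ≤ y) :
    |Real.log y ^ 2 - Real.log x ^ 2 - 2 * Real.log x / x * (y - x)| ≤
      ((1 + (x / ε) ^ 2) + 2 * |Real.log x| * (x / ε)) / x ^ 2 * (y - x) ^ 2 := by
  have hy0 : 0 < y := hε.trans_le hy
  set u := y / x with hu
  have hu0 : 0 < u := div_pos hy0 hx
  have hl : Real.log y = Real.log x + Real.log u := by
    rw [hu, Real.log_div hy0.ne' hx.ne']; ring
  have hyu : y = x * u := by rw [hu]; field_simp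
  have hv : 1 / u ≤ x / ε := by
    rw [hu, one_div_div]; gcongr
  have l1 : Real.log u ≤ u - 1 := Real.log_le_sub_one_of_pos hu0
  have l2 : 1 - u⁻¹ ≤ Real.log u := Real.one_sub_inv_le_log_of_pos hu0
  have huv : u * (1 / u) = 1 := by field_simp
  have hi : u⁻¹ = 1 / u := (one_div u).symm
  rw [hi] at l2
  set v := 1 / u with hvdef
  have hv0 : 0 < v := by positivity
  have e1 : 1 - v = (u - 1) * v := by linear_combination -huv
  have a1 : Real.log u ^ 2 ≤ (u - 1) ^ 2 * (1 + v ^ 2) := by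
    rcases le_total 0 (Real.log u) with h | h
    · nlinarith [mul_nonneg (sq_nonneg (u - 1)) (sq_nonneg v)]
    · have : Real.log u ^ 2 ≤ ((u - 1) * v) ^ 2 := by
        rw [← e1]; nlinarith
      nlinarith [sq_nonneg (u - 1)]
  have a2 : |Real.log u - (u - 1)| ≤ (u - 1) ^ 2 * v := by
    rw [abs_le]
    constructor
    · have : (u - 1) ^ 2 * v = (u - 1) - (1 - v) := by linear_combination (u - 2) * huv
      linarith
    · nlinarith [mul_nonneg (sq_nonneg (u - 1)) hv0.le]
  have e2 : Real.log y ^ 2 - Real.log x ^ 2 - 2 * Real.log x / x * (y - x) =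
      Real.log u ^ 2 + 2 * Real.log x * (Real.log u - (u - 1)) := by
    rw [hl, hyu]; field_simp; ring
  have e3 : ((1 + (x / ε) ^ 2) + 2 * |Real.log x| * (x / ε)) / x ^ 2 * (y - x) ^ 2 =
      (u - 1) ^ 2 * (1 + (x / ε) ^ 2) + 2 * |Real.log x| * ((u - 1) ^ 2 * (x / ε)) := by
    have : (y - x) ^ 2 = (u - 1) ^ 2 * x ^ 2 := by rw [hyu]; ring
    rw [this]; field_simp
  rw [e2, e3]
  refine (abs_add_le _ _).trans (add_le_add ?_ ?_)
  · rw [abs_of_nonneg (sq_nonneg _)]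
    refine a1.trans ?_
    gcongr
  · rw [abs_mul, abs_mul, abs_two]
    gcongr
    refine a2.trans ?_
    gcongr

/-- Each term is expanded over pairs of eigenvalues with the overlap weights, which reduces the
second-order estimate to `abs_log_sq_sub_le`. -/
theorem norm_mlog_sq_sub_le {X : Matrix ι ι 𝕜} (hX : X.PosDef) :
    ∃ ε > 0, ∃ C, 0 ≤ C ∧ ∀ Y : Matrix ι ι 𝕜, Y.IsHermitian → ‖Y - X‖ ≤ ε →
      Y.PosDef ∧ |‖mlog Y‖ ^ 2 - ‖mlog X‖ ^ 2 -
        RCLike.re (cfc (fun x => 2 * Real.log x / x) X * (Y - X)).trace| ≤ C * ‖Y - X‖ ^ 2 := by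
  -- Half the least eigenvalue: a perturbation of size ε then leaves all eigenvalues at least ε.
  obtain ⟨ε, hε, hXε⟩ : ∃ ε > 0, ∀ i, 2 * ε ≤ hX.1.eigenvalues i := by
    cases isEmpty_or_nonempty ι
    · exact ⟨1, one_pos, fun i => isEmptyElim i⟩
    · obtain ⟨i, hi⟩ := Finite.exists_min hX.1.eigenvalues
      exact ⟨hX.1.eigenvalues i / 2, half_pos (hX.eigenvalues_pos i), fun j => by
        rw [mul_div_cancel₀ _ (two_ne_zero)]; exact hi j⟩
  set c : ι → ℝ := fun i => ((1 + (hX.1.eigenvalues i / ε) ^ 2) +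
    2 * |Real.log (hX.1.eigenvalues i)| * (hX.1.eigenvalues i / ε)) / hX.1.eigenvalues i ^ 2
  have hc : ∀ i, 0 ≤ c i := fun i => by
    have := hX.eigenvalues_pos i
    positivity
  refine ⟨ε, hε, ∑ i, c i, Finset.sum_nonneg fun i _ => hc i, fun Y hY hYX => ?_⟩
  have hYε : ∀ j, ε ≤ hY.eigenvalues j := fun j => by
    obtain ⟨i, hi⟩ := exists_eigenvalue_near hX.1 hY j
    have := hXε i
    have := (abs_le.1 hi).1
    linarith
  refine ⟨hY.posDef_iff_eigenvalues_pos.2 fun j => hε.trans_le (hYε j), ?_⟩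
  have e1 : ‖mlog Y‖ ^ 2 = RCLike.re (cfc (fun _ : ℝ => (1 : ℝ)) X *
      cfc (fun x : ℝ => Real.log x ^ 2) Y).trace := by
    rw [cfc_one_fun hX.1, Matrix.one_mul, mlog, norm_cfc_sq hY, re_trace_cfc hY]
  have e2 : ‖mlog X‖ ^ 2 = RCLike.re (cfc (fun x : ℝ => Real.log x ^ 2) X *
      cfc (fun _ : ℝ => (1 : ℝ)) Y).trace := by
    rw [cfc_one_fun hY, Matrix.mul_one, mlog, norm_cfc_sq hX.1, re_trace_cfc hX.1]
  have e3 : RCLike.re (cfc (fun x => 2 * Real.log x / x) X * (Y - X)).trace =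
      RCLike.re (cfc (fun x => 2 * Real.log x / x) X * cfc (fun x : ℝ => x) Y).trace -
      RCLike.re (cfc (fun x => 2 * Real.log x / x * x) X * cfc (fun _ : ℝ => (1 : ℝ)) Y).trace := by
    rw [cfc_id_fun hY, cfc_one_fun hY, ← cfc_mul_cfc (fun x => 2 * Real.log x / x) (fun x => x),
      cfc_id_fun hX.1, Matrix.mul_one, Matrix.mul_sub, Matrix.trace_sub, map_sub]
  rw [e1, e2, e3, re_trace_cfc_mul_cfc hX.1 hY, re_trace_cfc_mul_cfc hX.1 hY,
    re_trace_cfc_mul_cfc hX.1 hY, re_trace_cfc_mul_cfc hX.1 hY, norm_sub_sq_eq_overlap hX.1 hY,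
    Finset.mul_sum]
  simp only [← Finset.sum_sub_distrib, Finset.mul_sum]
  refine (Finset.abs_sum_le_sum_abs _ _).trans (Finset.sum_le_sum fun i _ => ?_)
  refine (Finset.abs_sum_le_sum_abs _ _).trans (Finset.sum_le_sum fun j _ => ?_)
  rw [← mul_assoc]
  have hw := overlap_nonneg hX.1 hY i j
  set w := overlap hX.1 hY i j
  set x := hX.1.eigenvalues i with hxd
  set y := hY.eigenvalues j
  have e4 : 1 * Real.log y ^ 2 * w - Real.log x ^ 2 * 1 * w -
      (2 * Real.log x / x * y * w - 2 * Real.log x / x * x * 1 * w) =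
      (Real.log y ^ 2 - Real.log x ^ 2 - 2 * Real.log x / x * (y - x)) * w := by ring
  rw [e4, abs_mul, abs_of_nonneg hw]
  refine mul_le_mul_of_nonneg_right ?_ hw
  refine (abs_log_sq_sub_le (hX.eigenvalues_pos i) hε (hYε j)).trans ?_
  exact mul_le_mul_of_nonneg_right
    (Finset.single_le_sum (f := c) (fun i _ => hc i) (Finset.mem_univ i)) (sq_nonneg _)

/-- The real linear functional `Y ↦ Re tr (G Y)`. -/
def reTraceMul (G : Matrix ι ι 𝕜) : Matrix ι ι 𝕜 →L[ℝ] ℝ :=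
  LinearMap.toContinuousLinearMap
    { toFun := fun Y => RCLike.re (G * Y).trace
      map_add' := fun Y Z => by simp [Matrix.mul_add]
      map_smul' := fun c Y => by
        simp [Matrix.trace_smul, RCLike.real_smul_eq_coe_mul] }

theorem reTraceMul_apply (G Y : Matrix ι ι 𝕜) :
    reTraceMul G Y = RCLike.re (G * Y).trace := rfl

/-- The derivative is taken within the Hermitian matrices, outside which the functional calculus
only has its default value. -/
theorem hasFDerivWithinAt_norm_mlog_sq {X : Matrix ι ι 𝕜} (hX : X.PosDef) :
    HasFDerivWithinAt (fun Y : Matrix ι ι 𝕜 => ‖mlog Y‖ ^ 2)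
      (reTraceMul (cfc (fun x => 2 * Real.log x / x) X)) {Y | Y.IsHermitian} X := by
  obtain ⟨ε, hε, C, hC, h⟩ := norm_mlog_sq_sub_le hX
  refine HasFDerivWithinAt.of_isLittleO ?_
  have hO : (fun Y => ‖mlog Y‖ ^ 2 - ‖mlog X‖ ^ 2 -
      reTraceMul (cfc (fun x => 2 * Real.log x / x) X) (Y - X))
      =O[nhdsWithin X {Y | Y.IsHermitian}] fun Y => ‖Y - X‖ ^ 2 := by
    refine Asymptotics.IsBigO.of_bound C ?_
    filter_upwards [self_mem_nhdsWithin,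
      mem_nhdsWithin_of_mem_nhds (Metric.closedBall_mem_nhds X hε)] with Y hY hYX
    rw [Metric.mem_closedBall, dist_eq_norm] at hYX
    rw [Real.norm_of_nonneg (sq_nonneg ‖Y - X‖), Real.norm_eq_abs]
    exact (h Y hY hYX).2
  refine hO.trans_isLittleO (Asymptotics.IsLittleO.mono ?_ nhdsWithin_le_nhds)
  exact (Asymptotics.isLittleO_norm_pow_id one_lt_two).comp_tendsto
    (tendsto_sub_nhds_zero_iff.2 Filter.tendsto_id)

theorem hasDerivAt_norm_mlog_sq {α : ℝ → Matrix ι ι 𝕜} {V : Matrix ι ι 𝕜} {s : ℝ}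
    (hα : HasDerivAt α V s) (hs : (α s).PosDef) (hH : ∀ᶠ t in nhds s, (α t).IsHermitian) :
    HasDerivAt (fun t => ‖mlog (α t)‖ ^ 2)
      (RCLike.re (cfc (fun x => 2 * Real.log x / x) (α s) * V).trace) s :=
  HasFDerivWithinAt.comp_hasDerivAt s (hasFDerivWithinAt_norm_mlog_sq hs) hα hH

theorem continuousOn_norm_mlog_sq :
    ContinuousOn (fun Y : Matrix ι ι 𝕜 => ‖mlog Y‖ ^ 2) {Y | Y.PosDef} := fun _ hX =>
  (hasFDerivWithinAt_norm_mlog_sq hX).continuousWithinAt.mono fun _ hY => hY.1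

/-! ### Semiparallelogram law for `‖log‖²` along geodesics -/

/-- The logarithmic mean of z and w is at most their arithmetic mean. -/
theorem two_mul_sq_le_mul_log_sub {z w c s : ℝ} (hz : 0 < z) (hw : 0 < w)
    (h : c * (z - w) = s * (z + w)) : 2 * s ^ 2 ≤ s * (c * (Real.log z - Real.log w)) := by
  have key : ∀ {z w : ℝ}, 0 < w → w ≤ z →
      2 * ((z - w) / (z + w)) ≤ Real.log z - Real.log w := fun {z w} hw hwz => by
    have hz : 0 < z := hw.trans_le hwz
    -- This is 2x/(x + 2) ≤ log(1 + x) at x = z/w - 1.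
    have h1 := Real.le_log_one_add_of_nonneg (x := z / w - 1)
      (by rw [sub_nonneg, one_le_div hw]; exact hwz)
    rw [add_sub_cancel, Real.log_div hz.ne' hw.ne'] at h1
    refine le_trans (le_of_eq ?_) h1
    field_simp
    ring_nf
    field_simp
    ring
  have hs : s = c * ((z - w) / (z + w)) := by
    field_simp; linarith
  have h2 : 2 * ((z - w) / (z + w)) ^ 2 ≤ (z - w) / (z + w) * (Real.log z - Real.log w) := by
    rcases le_total w z with hwz | hwz
    · have := mul_le_mul_of_nonneg_left (key hw hwz)
        (div_nonneg (sub_nonneg.2 hwz) (add_pos hz hw).le)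
      linarith
    · have := mul_le_mul_of_nonneg_left (key hz hwz)
        (div_nonneg (sub_nonneg.2 hwz) (add_pos hw hz).le)
      have e : (w - z) / (w + z) = -((z - w) / (z + w)) := by
        rw [add_comm w z, ← neg_div, neg_sub]
      rw [e] at this
      nlinarith
  rw [hs]
  nlinarith [mul_le_mul_of_nonneg_left h2 (sq_nonneg c)]

theorem re_trace_conjTranspose_mul_eq_of_unitary {U V : Matrix ι ι 𝕜} (hU : U * Uᴴ = 1)
    (hV : V * Vᴴ = 1) (A B : Matrix ι ι 𝕜) :
    RCLike.re (Aᴴ * B).trace = RCLike.re ((Vᴴ * A * U)ᴴ * (Vᴴ * B * U)).trace := by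
  congr 1
  simp only [Matrix.conjTranspose_mul, Matrix.conjTranspose_conjTranspose]
  calc (Aᴴ * B).trace = (Aᴴ * (V * Vᴴ) * B * (U * Uᴴ)).trace := by
        rw [hV, hU, Matrix.mul_one, Matrix.mul_one]
    _ = (Uᴴ * (Aᴴ * (V * Vᴴ) * B * U)).trace := by
        rw [Matrix.trace_mul_comm Uᴴ]; simp only [Matrix.mul_assoc]
    _ = _ := by simp only [Matrix.mul_assoc]

/-- Here W = E⁻¹ZE⁻¹. With S = E - E⁻¹ and C = E + E⁻¹, this relation becomes c(z - w) = s(z + w)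
for the entries of C and S in eigenbases of W and Z, and the scalar inequality is summed over
entries. -/
theorem two_mul_norm_sub_inv_sq_le {E Z W : Matrix ι ι 𝕜} (hE : E.PosDef) (hZ : Z.PosDef)
    (hW : W.PosDef) (h : E⁻¹ * Z = W * E) :
    2 * ‖E - E⁻¹‖ ^ 2 ≤ RCLike.re ((E * E - E⁻¹ * E⁻¹) * (mlog Z - mlog W)).trace := by
  have hEu : IsUnit E.det := (Matrix.isUnit_iff_isUnit_det _).1 hE.isUnit
  have hE1 : E * E⁻¹ = 1 := Matrix.mul_nonsing_inv _ hEu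
  have hE2 : E⁻¹ * E = 1 := Matrix.nonsing_inv_mul _ hEu
  set S := E - E⁻¹ with hS
  set C := E + E⁻¹ with hC
  have hSH : Sᴴ = S := (hE.1.sub hE.inv.1).eq
  have hCZ : C * Z - W * C = S * Z + W * S := by
    have e : C * Z - W * C - (S * Z + W * S) = (E⁻¹ * Z - W * E) + (E⁻¹ * Z - W * E) := by
      rw [hS, hC]; noncomm_ring
    rw [← sub_eq_zero, e, h, sub_self, add_zero]
  have hSC : S * C = E * E - E⁻¹ * E⁻¹ := by
    rw [hS, hC, Matrix.mul_add, Matrix.sub_mul, Matrix.sub_mul, hE1, hE2]; abel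
  have hCS : C * S = E * E - E⁻¹ * E⁻¹ := by
    rw [hS, hC, Matrix.add_mul, Matrix.mul_sub, Matrix.mul_sub, hE1, hE2]; abel
  -- As E² - E⁻² equals both SC and CS, one factor C can be placed so that each logarithm acts on
  -- its own side of C.
  have e1 : RCLike.re ((E * E - E⁻¹ * E⁻¹) * (mlog Z - mlog W)).trace =
      RCLike.re (Sᴴ * (C * mlog Z - mlog W * C)).trace := by
    congr 1
    rw [hSH, Matrix.mul_sub, Matrix.mul_sub, Matrix.trace_sub, Matrix.trace_sub]
    congr 1
    · rw [← hSC, Matrix.mul_assoc]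
    · rw [← hCS, ← Matrix.mul_assoc S, Matrix.trace_mul_comm (S * mlog W), Matrix.mul_assoc]
  set U := (hZ.1.eigenvectorUnitary : Matrix ι ι 𝕜) with hU
  set V := (hW.1.eigenvectorUnitary : Matrix ι ι 𝕜) with hV
  have hUU := eigenvectorUnitary_mul_conjTranspose hZ.1
  have hUU' := conjTranspose_eigenvectorUnitary_mul hZ.1
  have hVV := eigenvectorUnitary_mul_conjTranspose hW.1
  have hVV' := conjTranspose_eigenvectorUnitary_mul hW.1
  rw [← hU] at hUU hUU'
  rw [← hV] at hVV hVV'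
  have right : ∀ (A : Matrix ι ι 𝕜) (f : ℝ → ℝ) (j i : ι), (Vᴴ * (A * cfc f Z) * U) j i =
      (f (hZ.1.eigenvalues i) : 𝕜) * (Vᴴ * A * U) j i := fun A f j i => by
    have : Vᴴ * (A * cfc f Z) * U =
        Vᴴ * A * U * Matrix.diagonal (fun i => (f (hZ.1.eigenvalues i) : 𝕜)) := by
      rw [cfc_eq_mul_diagonal_mul hZ.1, ← hU]
      simp only [Matrix.mul_assoc, hUU', Matrix.mul_one]
    rw [this, Matrix.mul_diagonal, mul_comm]
  have left : ∀ (A : Matrix ι ι 𝕜) (f : ℝ → ℝ) (j i : ι), (Vᴴ * (cfc f W * A) * U) j i =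
      (f (hW.1.eigenvalues j) : 𝕜) * (Vᴴ * A * U) j i := fun A f j i => by
    have : Vᴴ * (cfc f W * A) * U =
        Matrix.diagonal (fun i => (f (hW.1.eigenvalues i) : 𝕜)) * (Vᴴ * A * U) := by
      rw [cfc_eq_mul_diagonal_mul hW.1, ← hV]
      simp only [← Matrix.mul_assoc, hVV', Matrix.one_mul]
    rw [this, Matrix.diagonal_mul]
  have entry : ∀ j i, (Vᴴ * C * U) j i *
      ((hZ.1.eigenvalues i - hW.1.eigenvalues j : ℝ) : 𝕜) =
      (Vᴴ * S * U) j i * ((hZ.1.eigenvalues i + hW.1.eigenvalues j : ℝ) : 𝕜) := fun j i => by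
    have e : (Vᴴ * (C * Z - W * C) * U) j i = (Vᴴ * (S * Z + W * S) * U) j i := by rw [hCZ]
    simp only [Matrix.mul_sub, Matrix.sub_mul, Matrix.mul_add, Matrix.add_mul,
      Matrix.sub_apply, Matrix.add_apply] at e
    have r := fun A => right A (fun x => x) j i
    have l := fun A => left A (fun x => x) j i
    simp only [cfc_id_fun hZ.1, cfc_id_fun hW.1] at r l
    rw [r, l, r, l] at e
    push_cast
    linear_combination e
  rw [e1, re_trace_conjTranspose_mul_eq_of_unitary hUU hVV, re_trace_conjTranspose_mul,
    ← re_trace_conjTranspose_mul_self, re_trace_conjTranspose_mul_eq_of_unitary hUU hVV,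
    re_trace_conjTranspose_mul, Finset.mul_sum]
  refine Finset.sum_le_sum fun i _ => ?_
  rw [Finset.mul_sum]
  refine Finset.sum_le_sum fun j _ => ?_
  have el : (Vᴴ * (C * mlog Z - mlog W * C) * U) j i = (Vᴴ * C * U) j i *
      ((Real.log (hZ.1.eigenvalues i) - Real.log (hW.1.eigenvalues j) : ℝ) : 𝕜) := by
    rw [Matrix.mul_sub, Matrix.sub_mul, Matrix.sub_apply, mlog, mlog, right, left]
    push_cast; ring
  rw [el]
  have hent := entry j i
  set c := (Vᴴ * C * U) j i
  set s := (Vᴴ * S * U) j i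
  have hz := hZ.eigenvalues_pos i
  have hw := hW.eigenvalues_pos j
  set z := hZ.1.eigenvalues i
  set w := hW.1.eigenvalues j
  -- The eigenvalues are real, so the relation splits into real and imaginary parts, each subject to
  -- the scalar inequality.
  have hre : RCLike.re c * (z - w) = RCLike.re s * (z + w) := by
    have := congrArg RCLike.re hent
    rwa [RCLike.re_mul_ofReal, RCLike.re_mul_ofReal] at this
  have him : RCLike.im c * (z - w) = RCLike.im s * (z + w) := by
    have := congrArg RCLike.im hent
    rwa [RCLike.im_mul_ofReal, RCLike.im_mul_ofReal] at this
  have h1 := two_mul_sq_le_mul_log_sub hz hw hre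
  have h2 := two_mul_sq_le_mul_log_sub hz hw him
  rw [RCLike.star_def, RCLike.mul_re, RCLike.mul_re, RCLike.conj_re, RCLike.conj_im,
    RCLike.re_mul_ofReal, RCLike.im_mul_ofReal]
  linarith

/-- The curve `s ↦ M^{-s/2} Z M^{-s/2}`. -/
def pullCurve (M Z : Matrix ι ι 𝕜) (s : ℝ) : Matrix ι ι 𝕜 :=
  mpow M (-s / 2) * Z * mpow M (-s / 2)

section

variable {M Z : Matrix ι ι 𝕜}

theorem _root_.Matrix.PosDef.conj_posDef {E Z : Matrix ι ι 𝕜} (hE : E.PosDef) (hZ : Z.PosDef) :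
    (E * Z * E).PosDef := by
  have := (Matrix.IsUnit.posDef_star_right_conjugate_iff hE.isUnit).2 hZ
  rwa [Matrix.star_eq_conjTranspose, hE.1.eq] at this

theorem posDef_pullCurve (hM : M.PosDef) (hZ : Z.PosDef) (s : ℝ) : (pullCurve M Z s).PosDef :=
  (posDef_mpow hM _).conj_posDef hZ

theorem pullCurve_zero (hM : M.PosDef) : pullCurve M Z 0 = Z := by
  simp [pullCurve, mpow_zero hM]

theorem two_mul_norm_mpow_sub_sq_le (hM : M.PosDef) (hZ : Z.PosDef) (r t : ℝ) :
    2 * ‖mpow M (t / 2) - mpow M (-(t / 2))‖ ^ 2 ≤ RCLike.re ((mpow M t - mpow M (-t)) *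
      (mlog (pullCurve M Z r) - mlog (pullCurve M Z (r + t)))).trace := by
  have h := two_mul_norm_sub_inv_sq_le (posDef_mpow hM (t / 2)) (posDef_pullCurve hM hZ r)
    (posDef_pullCurve hM hZ (r + t)) (by
      rw [inv_mpow hM, pullCurve, pullCurve]
      have e1 : mpow M (-(r + t) / 2) = mpow M (-(t / 2)) * mpow M (-r / 2) := by
        rw [mpow_mul_mpow hM]; ring_nf
      have e2 : mpow M (-(r + t) / 2) * mpow M (t / 2) = mpow M (-r / 2) := by
        rw [mpow_mul_mpow hM]; ring_nf
      rw [Matrix.mul_assoc _ _ (mpow M (t / 2)), e2, e1]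
      simp only [Matrix.mul_assoc])
  rw [inv_mpow hM, mpow_mul_mpow hM, mpow_mul_mpow hM, add_halves] at h
  rwa [← neg_add, add_halves] at h

/-- The one-step inequality has the same matrix M^t - M^{-t} at every base point, so n consecutive
steps telescope. -/
theorem nat_mul_norm_mpow_sub_sq_le (hM : M.PosDef) (hZ : Z.PosDef) (r t : ℝ) (n : ℕ) :
    n * (2 * ‖mpow M (t / 2) - mpow M (-(t / 2))‖ ^ 2) ≤ RCLike.re ((mpow M t - mpow M (-t)) *
      (mlog (pullCurve M Z r) - mlog (pullCurve M Z (r + n * t)))).trace := by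
  induction n with
  | zero => simp
  | succ n ih =>
    have h := two_mul_norm_mpow_sub_sq_le hM hZ (r + n * t) t
    have e : r + n * t + t = r + ((n + 1 : ℕ) : ℝ) * t := by push_cast; ring
    rw [e] at h
    have e2 : mlog (pullCurve M Z r) - mlog (pullCurve M Z (r + ((n + 1 : ℕ) : ℝ) * t)) =
      (mlog (pullCurve M Z r) - mlog (pullCurve M Z (r + n * t))) +
      (mlog (pullCurve M Z (r + n * t)) - mlog (pullCurve M Z (r + ((n + 1 : ℕ) : ℝ) * t))) := by
      abel
    rw [e2, Matrix.mul_add, Matrix.trace_add, map_add]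
    push_cast at *
    linarith

theorem tendsto_inv_smul_mpow_sub (hM : M.PosDef) :
    Filter.Tendsto (fun t : ℝ => t⁻¹ • (mpow M t - mpow M (-t))) (nhdsWithin 0 {0}ᶜ)
      (nhds ((2 : ℝ) • mlog M)) := by
  have h1 : HasDerivAt (fun t => mpow M t) (mlog M) 0 :=
    (hasDerivAt_mpow hM 0).congr_deriv (by rw [mpow_zero hM, Matrix.mul_one])
  have h2 : HasDerivAt (fun t => mpow M (-t)) ((-1 : ℝ) • mlog M) 0 := by
    rw [← neg_zero] at h1
    exact HasDerivAt.scomp (0 : ℝ) h1 (hasDerivAt_neg (0 : ℝ))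
  have h3 := (h1.sub h2).tendsto_slope_zero
  have e : mlog M - (-1 : ℝ) • mlog M = (2 : ℝ) • mlog M := by
    rw [neg_one_smul, sub_neg_eq_add, two_smul]
  rw [e] at h3
  refine h3.congr fun t => ?_
  simp [mpow_zero hM]

/-- Infinitesimal form of the law of cosines along a geodesic. -/
theorem mul_norm_mlog_sq_le (hM : M.PosDef) (hZ : Z.PosDef) (r : ℝ) {s : ℝ} (hs : 0 < s) :
    s * ‖mlog M‖ ^ 2 ≤ RCLike.re (mlog M *
      (mlog (pullCurve M Z r) - mlog (pullCurve M Z (r + s)))).trace := by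
  set D := mlog (pullCurve M Z r) - mlog (pullCurve M Z (r + s)) with hD
  -- The length s is cut into n + 1 steps t. After division by t, the right side involves the
  -- difference quotient at t and the left side the square of the one at t/2.
  have hτ : Filter.Tendsto (fun n : ℕ => s / ((n : ℝ) + 1)) Filter.atTop
      (nhdsWithin 0 {0}ᶜ) := by
    refine tendsto_nhdsWithin_iff.2 ⟨?_, Filter.Eventually.of_forall fun n => ?_⟩
    · have := (tendsto_one_div_add_atTop_nhds_zero_nat (𝕜 := ℝ)).const_mul s
      simpa [div_eq_mul_inv] using this
    · have : (0 : ℝ) < s / ((n : ℝ) + 1) := by positivity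
      exact this.ne'
  have hτ2 : Filter.Tendsto (fun n : ℕ => s / ((n : ℝ) + 1) / 2) Filter.atTop
      (nhdsWithin 0 {0}ᶜ) := by
    refine tendsto_nhdsWithin_iff.2 ⟨?_, Filter.Eventually.of_forall fun n => ?_⟩
    · simpa using (tendsto_nhdsWithin_iff.1 hτ).1.div_const 2
    · have : (0 : ℝ) < s / ((n : ℝ) + 1) / 2 := by positivity
      exact this.ne'
  have hcont : Continuous fun Q : Matrix ι ι 𝕜 => RCLike.re (Q * D).trace := by
    have : (fun Q : Matrix ι ι 𝕜 => RCLike.re (Q * D).trace) = reTraceMul D := by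
      ext Q; rw [reTraceMul_apply, Matrix.trace_mul_comm]
    rw [this]; exact (reTraceMul D).continuous
  have l1 := (hcont.tendsto _).comp ((tendsto_inv_smul_mpow_sub hM).comp hτ)
  have l2 := ((((tendsto_inv_smul_mpow_sub hM).comp hτ2).norm).pow 2).const_mul (s / 2)
  have hle := le_of_tendsto_of_tendsto' l2 l1 fun n => ?_
  · rw [norm_smul, Matrix.smul_mul, Matrix.trace_smul, RCLike.smul_re, Real.norm_two] at hle
    nlinarith
  · simp only [Function.comp_apply]
    have hn : (0 : ℝ) < (n : ℝ) + 1 := by positivity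
    have h := nat_mul_norm_mpow_sub_sq_le hM hZ r (s / ((n : ℝ) + 1)) (n + 1)
    have e : r + ((n + 1 : ℕ) : ℝ) * (s / ((n : ℝ) + 1)) = r + s := by
      push_cast; field_simp
    rw [e, ← hD] at h
    rw [Matrix.smul_mul, Matrix.trace_smul, RCLike.smul_re, norm_smul, mul_pow]
    set t := s / ((n : ℝ) + 1) with ht
    have ht0 : 0 < t := by positivity
    have hn2 : (((n + 1 : ℕ) : ℝ)) = s / t := by rw [ht]; push_cast; field_simp
    rw [hn2] at h
    have h' := mul_le_mul_of_nonneg_left h (inv_nonneg.2 ht0.le)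
    refine le_trans (le_of_eq ?_) h'
    rw [norm_inv, Real.norm_of_nonneg (by positivity : 0 ≤ t / 2)]
    field_simp

theorem hasDerivAt_pullCurve (hM : M.PosDef) (s : ℝ) :
    HasDerivAt (pullCurve M Z)
      ((-1 / 2 : ℝ) • (mlog M * pullCurve M Z s + pullCurve M Z s * mlog M)) s := by
  have h0 : HasDerivAt (fun s : ℝ => -s / 2) (-1 / 2) s := (hasDerivAt_neg s).div_const 2
  have h1 : HasDerivAt (fun s : ℝ => mpow M (-s / 2))
      ((-1 / 2 : ℝ) • (mlog M * mpow M (-s / 2))) s :=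
    HasDerivAt.scomp s (hasDerivAt_mpow hM _) h0
  have h2 := (h1.mul_const Z).mul h1
  refine h2.congr_deriv ?_
  rw [pullCurve, mlog_mul_mpow_comm, smul_add]
  simp only [Matrix.smul_mul, Matrix.mul_smul, ← Matrix.mul_assoc]
  rw [mlog_mul_mpow_comm]

/-- In the chain rule the factor Y of the velocity cancels the 1/x in 2 log x / x, by cyclicity of
the trace. -/
theorem hasDerivAt_norm_mlog_pullCurve_sq (hM : M.PosDef) (hZ : Z.PosDef) (s : ℝ) :
    HasDerivAt (fun s => ‖mlog (pullCurve M Z s)‖ ^ 2)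
      (-2 * RCLike.re (mlog M * mlog (pullCurve M Z s)).trace) s := by
  have h := hasDerivAt_norm_mlog_sq (hasDerivAt_pullCurve hM s) (posDef_pullCurve hM hZ s)
    (Filter.Eventually.of_forall fun t => (posDef_pullCurve hM hZ t).1)
  refine h.congr_deriv ?_
  have hY := posDef_pullCurve hM hZ s
  set Y := pullCurve M Z s
  set g : ℝ → ℝ := fun x => 2 * Real.log x / x with hg
  have e1 : cfc g Y * Y = (2 : ℝ) • mlog Y := by
    conv_lhs => rw [← cfc_id_fun hY.1, cfc_id_fun hY.1]
    nth_rewrite 2 [← cfc_id_fun hY.1]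
    rw [cfc_mul_cfc, mlog, smul_cfc]
    refine cfc_congr_eigenvalues hY.1 fun i => ?_
    have := (hY.eigenvalues_pos i).ne'
    simp only [hg]; field_simp
  have e2 : Y * cfc g Y = (2 : ℝ) • mlog Y := by
    nth_rewrite 1 [← cfc_id_fun hY.1]
    rw [cfc_mul_cfc, mlog, smul_cfc]
    refine cfc_congr_eigenvalues hY.1 fun i => ?_
    have := (hY.eigenvalues_pos i).ne'
    simp only [hg]; field_simp
  have e3 : (cfc g Y * (mlog M * Y)).trace = (mlog M * ((2 : ℝ) • mlog Y)).trace := by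
    rw [← e2, Matrix.trace_mul_comm, Matrix.mul_assoc]
  have e4 : (cfc g Y * (Y * mlog M)).trace = (mlog M * ((2 : ℝ) • mlog Y)).trace := by
    rw [← e1, ← Matrix.mul_assoc, Matrix.trace_mul_comm]
  rw [Matrix.mul_smul, Matrix.trace_smul, RCLike.smul_re, Matrix.mul_add, Matrix.trace_add, e3, e4,
    map_add, Matrix.mul_smul, Matrix.trace_smul, RCLike.smul_re]
  ring

theorem norm_mlog_pullCurve_sq_le (hM : M.PosDef) (hZ : Z.PosDef) {t : ℝ} (ht0 : 0 ≤ t)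
    (ht1 : t ≤ 1) :
    ‖mlog (pullCurve M Z t)‖ ^ 2 ≤ (1 - t) * ‖mlog Z‖ ^ 2 +
      t * ‖mlog (pullCurve M Z 1)‖ ^ 2 - t * (1 - t) * ‖mlog M‖ ^ 2 := by
  set ψ : ℝ → ℝ := fun s => ‖mlog (pullCurve M Z s)‖ ^ 2 - s ^ 2 * ‖mlog M‖ ^ 2 with hψ
  have hd : ∀ s, HasDerivAt ψ (-2 * RCLike.re (mlog M * mlog (pullCurve M Z s)).trace -
      2 * s * ‖mlog M‖ ^ 2) s := fun s => by
    have h2 := ((hasDerivAt_id s).pow 2).mul_const (‖mlog M‖ ^ 2)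
    refine ((hasDerivAt_norm_mlog_pullCurve_sq hM hZ s).sub h2).congr_deriv ?_
    simp
  -- This is exactly what `mul_norm_mlog_sq_le` provides; convexity of ψ between 0 and 1 is then the
  -- claim.
  have hmono : Monotone (deriv ψ) := by
    refine monotone_iff_forall_lt.2 fun a b hab => ?_
    rw [(hd a).deriv, (hd b).deriv]
    have h := mul_norm_mlog_sq_le hM hZ a (sub_pos.2 hab)
    rw [add_sub_cancel, Matrix.mul_sub, Matrix.trace_sub, map_sub] at h
    linarith
  have hconv := hmono.convexOn_univ_of_deriv fun s => (hd s).differentiableAt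
  have h := hconv.2 (Set.mem_univ 0) (Set.mem_univ 1) (sub_nonneg.2 ht1) ht0 (by ring)
  simp only [hψ, smul_eq_mul, mul_zero, mul_one, zero_add, pullCurve_zero hM] at h
  nlinarith

end

/-! ### The closed form of the distance -/

/-- The closed form `‖log (A^{-1/2} B A^{-1/2})‖` of the trace Riemannian distance. -/
def logDist (A B : Matrix ι ι 𝕜) : ℝ := ‖mlog (mpow A (-1 / 2) * B * mpow A (-1 / 2))‖

theorem logDist_nonneg (A B : Matrix ι ι 𝕜) : 0 ≤ logDist A B := norm_nonneg _

/-- The norm depends on the eigenvalues only. Symmetry and congruence invariance of `logDist` thus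
reduce to charpoly(XY) = charpoly(YX). -/
theorem norm_mlog_eq_of_charpoly_eq {X Y : Matrix ι ι 𝕜} (hX : X.IsHermitian) (hY : Y.IsHermitian)
    (h : X.charpoly = Y.charpoly) : ‖mlog X‖ = ‖mlog Y‖ := by
  rw [← sq_eq_sq₀ (norm_nonneg _) (norm_nonneg _), mlog, mlog, norm_cfc_sq hX, norm_cfc_sq hY,
    (Matrix.IsHermitian.eigenvalues_eq_eigenvalues_iff hX hY).2 h]

section

variable {A B E Z : Matrix ι ι 𝕜}

theorem posDef_whiten (hA : A.PosDef) (hB : B.PosDef) :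
    (mpow A (-1 / 2) * B * mpow A (-1 / 2)).PosDef := (posDef_mpow hA _).conj_posDef hB

theorem charpoly_whiten (hA : A.PosDef) (B : Matrix ι ι 𝕜) :
    (mpow A (-1 / 2) * B * mpow A (-1 / 2)).charpoly = (A⁻¹ * B).charpoly := by
  rw [Matrix.charpoly_mul_comm, ← Matrix.mul_assoc, mpow_neg_half_mul_mpow_neg_half hA]

theorem logDist_conj (hA : A.PosDef) (hB : B.PosDef) (hE : E.PosDef) :
    logDist (E * A * E) (E * B * E) = logDist A B := by
  have hEA := hE.conj_posDef hA
  have hEB := hE.conj_posDef hB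
  refine norm_mlog_eq_of_charpoly_eq (posDef_whiten hEA hEB).1 (posDef_whiten hA hB).1 ?_
  have hEu : IsUnit E.det := (Matrix.isUnit_iff_isUnit_det _).1 hE.isUnit
  rw [charpoly_whiten hEA, charpoly_whiten hA, Matrix.mul_inv_rev, Matrix.mul_inv_rev,
    Matrix.charpoly_mul_comm]
  have : E * B * E * (E⁻¹ * (A⁻¹ * E⁻¹)) = E * B * (E * E⁻¹) * (A⁻¹ * E⁻¹) := by
    simp only [Matrix.mul_assoc]
  rw [this, Matrix.mul_nonsing_inv _ hEu, Matrix.mul_one, Matrix.mul_assoc,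
    Matrix.charpoly_mul_comm]
  have : B * (A⁻¹ * E⁻¹) * E = B * A⁻¹ * (E⁻¹ * E) := by simp only [Matrix.mul_assoc]
  rw [this, Matrix.nonsing_inv_mul _ hEu, Matrix.mul_one, Matrix.charpoly_mul_comm]

theorem mlog_inv (hA : A.PosDef) : mlog A⁻¹ = -mlog A := by
  have h := inv_mpow hA 1
  rw [mpow_one hA] at h
  rw [h, mlog_mpow hA, neg_one_smul]

theorem logDist_comm (hA : A.PosDef) (hB : B.PosDef) : logDist A B = logDist B A := by
  have hP := posDef_whiten hA hB
  rw [logDist, ← norm_neg, ← mlog_inv hP]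
  refine norm_mlog_eq_of_charpoly_eq hP.inv.1 (posDef_whiten hB hA).1 ?_
  rw [charpoly_whiten hB, Matrix.mul_inv_rev, Matrix.mul_inv_rev, neg_div, inv_mpow hA, neg_neg,
    ← Matrix.mul_assoc, Matrix.charpoly_mul_comm, ← Matrix.mul_assoc, mpow_half_mul_mpow_half hA,
    Matrix.charpoly_mul_comm]

theorem unwhiten (hA : A.PosDef) (B : Matrix ι ι 𝕜) :
    mpow A (1 / 2) * (mpow A (-1 / 2) * B * mpow A (-1 / 2)) * mpow A (1 / 2) = B := by
  have e : mpow A (1 / 2) * (mpow A (-1 / 2) * B * mpow A (-1 / 2)) * mpow A (1 / 2) =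
      (mpow A (1 / 2) * mpow A (-1 / 2)) * B * (mpow A (-1 / 2) * mpow A (1 / 2)) := by
    simp only [Matrix.mul_assoc]
  rw [e, mpow_half_mul_mpow_neg_half hA, mpow_neg_half_mul_mpow_half hA, Matrix.one_mul,
    Matrix.mul_one]

theorem whiten (hA : A.PosDef) (B : Matrix ι ι 𝕜) :
    mpow A (-1 / 2) * (mpow A (1 / 2) * B * mpow A (1 / 2)) * mpow A (-1 / 2) = B := by
  have e : mpow A (-1 / 2) * (mpow A (1 / 2) * B * mpow A (1 / 2)) * mpow A (-1 / 2) =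
      (mpow A (-1 / 2) * mpow A (1 / 2)) * B * (mpow A (1 / 2) * mpow A (-1 / 2)) := by
    simp only [Matrix.mul_assoc]
  rw [e, mpow_half_mul_mpow_neg_half hA, mpow_neg_half_mul_mpow_half hA, Matrix.one_mul,
    Matrix.mul_one]

theorem whiten_self (hA : A.PosDef) : mpow A (-1 / 2) * A * mpow A (-1 / 2) = 1 := by
  have := whiten hA 1
  rwa [Matrix.mul_one, mpow_half_mul_mpow_half hA] at this

theorem mlog_one : mlog (1 : Matrix ι ι 𝕜) = 0 := by
  have h : (1 : Matrix ι ι 𝕜).PosDef := Matrix.PosDef.one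
  have := mlog_mpow h 0
  rwa [mpow_zero h, zero_smul] at this

theorem logDist_self (hA : A.PosDef) : logDist A A = 0 := by
  rw [logDist, whiten_self hA, mlog_one, norm_zero]

theorem eq_of_logDist_eq_zero (hA : A.PosDef) (hB : B.PosDef) (h : logDist A B = 0) : A = B := by
  have h1 := eq_one_of_mlog_eq_zero (posDef_whiten hA hB) (norm_eq_zero.1 h)
  rw [← unwhiten hA B, h1, Matrix.mul_one, mpow_half_mul_mpow_half hA]

theorem posDef_geodesic (hA : A.PosDef) (hB : B.PosDef) (t : ℝ) : (geodesic A B t).PosDef :=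
  (posDef_mpow hA _).conj_posDef (posDef_mpow (posDef_whiten hA hB) t)

theorem geodesic_zero (hA : A.PosDef) (hB : B.PosDef) : geodesic A B 0 = A := by
  rw [geodesic, mpow_zero (posDef_whiten hA hB), Matrix.mul_one, mpow_half_mul_mpow_half hA]

theorem geodesic_one (hA : A.PosDef) (hB : B.PosDef) : geodesic A B 1 = B := by
  rw [geodesic, mpow_one (posDef_whiten hA hB), unwhiten hA]

theorem logDist_geodesic_right (hA : A.PosDef) (hB : B.PosDef) {t : ℝ} (ht : 0 ≤ t) :
    logDist A (geodesic A B t) = t * logDist A B := by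
  rw [logDist, geodesic, whiten hA, mlog_mpow (posDef_whiten hA hB), norm_smul,
    Real.norm_of_nonneg ht, logDist]

/-- Congruence by A^{-1/2} turns the geodesic into t ↦ P^t, starting at the identity. -/
theorem logDist_geodesic_left (hA : A.PosDef) (hB : B.PosDef) (hZ : Z.PosDef) (t : ℝ) :
    logDist (geodesic A B t) Z =
      ‖mlog (pullCurve (mpow A (-1 / 2) * B * mpow A (-1 / 2))
        (mpow A (-1 / 2) * Z * mpow A (-1 / 2)) t)‖ := by
  have hP := posDef_whiten hA hB
  conv_lhs => rw [← unwhiten hA Z, geodesic]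
  rw [logDist_conj (posDef_mpow hP t) (posDef_whiten hA hZ) (posDef_mpow hA _), logDist,
    mpow_mpow hP, pullCurve]
  ring_nf

/-- The trace Riemannian metric satisfies the semiparallelogram law along geodesics. -/
theorem logDist_geodesic_sq_le (hA : A.PosDef) (hB : B.PosDef) (hZ : Z.PosDef) {t : ℝ}
    (ht0 : 0 ≤ t) (ht1 : t ≤ 1) :
    logDist (geodesic A B t) Z ^ 2 ≤
      (1 - t) * logDist A Z ^ 2 + t * logDist B Z ^ 2 - t * (1 - t) * logDist A B ^ 2 := by
  have h := norm_mlog_pullCurve_sq_le (posDef_whiten hA hB) (posDef_whiten hA hZ) ht0 ht1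
  have h1 := logDist_geodesic_left hA hB hZ 1
  rw [geodesic_one hA hB] at h1
  rw [← logDist_geodesic_left hA hB hZ, ← h1] at h
  exact h

end

/-! ### Lengths of paths -/

/-- This form contains inverses but no square roots, which makes continuity of the speed and its
congruence invariance accessible. -/
theorem norm_mpow_mul_mul_mpow_sq {X : Matrix ι ι 𝕜} (hX : X.PosDef) (V : Matrix ι ι 𝕜) :
    ‖mpow X (-1 / 2) * V * mpow X (-1 / 2)‖ ^ 2 = RCLike.re (X⁻¹ * Vᴴ * X⁻¹ * V).trace := by
  rw [← re_trace_conjTranspose_mul_self, Matrix.conjTranspose_mul, Matrix.conjTranspose_mul,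
    (isHermitian_mpow X _).eq, ← Matrix.mul_assoc _ _ (mpow X (-1 / 2)), Matrix.trace_mul_comm,
    ← mpow_neg_half_mul_mpow_neg_half hX]
  simp only [Matrix.mul_assoc]

theorem norm_mpow_conj_mul_mul_mpow_conj {E X : Matrix ι ι 𝕜} (hE : E.PosDef) (hX : X.PosDef)
    (V : Matrix ι ι 𝕜) :
    ‖mpow (E * X * E) (-1 / 2) * (E * V * E) * mpow (E * X * E) (-1 / 2)‖ =
      ‖mpow X (-1 / 2) * V * mpow X (-1 / 2)‖ := by
  rw [← sq_eq_sq₀ (norm_nonneg _) (norm_nonneg _), norm_mpow_mul_mul_mpow_sq (hE.conj_posDef hX),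
    norm_mpow_mul_mul_mpow_sq hX]
  congr 1
  have hEu : IsUnit E.det := (Matrix.isUnit_iff_isUnit_det _).1 hE.isUnit
  have h1 : ∀ Y : Matrix ι ι 𝕜, E⁻¹ * (E * Y) = Y := fun Y =>
    Matrix.nonsing_inv_mul_cancel_left E Y hEu
  have h2 : ∀ Y : Matrix ι ι 𝕜, E * (E⁻¹ * Y) = Y := fun Y =>
    Matrix.mul_nonsing_inv_cancel_left E Y hEu
  rw [Matrix.conjTranspose_mul, Matrix.conjTranspose_mul, hE.1.eq, Matrix.mul_inv_rev,
    Matrix.mul_inv_rev]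
  simp only [Matrix.mul_assoc, h1, h2]
  rw [Matrix.trace_mul_comm]
  simp only [Matrix.mul_assoc, Matrix.mul_nonsing_inv _ hEu, Matrix.mul_one]

/-- Cauchy–Schwarz, after splitting 1/x symmetrically as x^{-1/2} x^{-1/2} around the logarithm. -/
theorem re_trace_cfc_mul_le {X : Matrix ι ι 𝕜} (hX : X.PosDef) (V : Matrix ι ι 𝕜) :
    RCLike.re (cfc (fun x => 2 * Real.log x / x) X * V).trace ≤
      2 * ‖mlog X‖ * ‖mpow X (-1 / 2) * V * mpow X (-1 / 2)‖ := by
  have e : cfc (fun x => 2 * Real.log x / x) X =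
      (2 : ℝ) • (mpow X (-1 / 2) * mlog X * mpow X (-1 / 2)) := by
    rw [mpow, mlog, cfc_mul_cfc, cfc_mul_cfc, smul_cfc]
    refine cfc_congr_eigenvalues hX.1 fun i => ?_
    have hx := hX.eigenvalues_pos i
    set x := hX.1.eigenvalues i
    have : x ^ (-1 / 2 : ℝ) * x ^ (-1 / 2 : ℝ) = x⁻¹ := by
      rw [← Real.rpow_add hx, ← Real.rpow_neg_one]; norm_num
    rw [div_eq_mul_inv, ← this]; ring
  have h := (abs_le.1 (abs_re_trace_mul_le (isHermitian_mlog X)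
    (mpow X (-1 / 2) * V * mpow X (-1 / 2)))).2
  rw [e, Matrix.smul_mul, Matrix.trace_smul, RCLike.smul_re, mul_assoc 2]
  refine mul_le_mul_of_nonneg_left (le_trans (le_of_eq ?_) h) zero_le_two
  rw [Matrix.mul_assoc, Matrix.mul_assoc, Matrix.trace_mul_comm]
  simp only [Matrix.mul_assoc]

/-- Evaluation of an entry, as a continuous linear map. -/
def entryCLM (i j : ι) : Matrix ι ι 𝕜 →L[ℝ] 𝕜 :=
  LinearMap.toContinuousLinearMap (Matrix.entryLinearMap ℝ 𝕜 i j)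

theorem matrix_eq_sum_entry_smul (X : Matrix ι ι 𝕜) :
    X = ∑ i, ∑ j, X i j • (Matrix.single i j 1 : Matrix ι ι 𝕜) := by
  conv_lhs => rw [Matrix.matrix_eq_sum_single X]
  simp [Matrix.smul_single]

theorem hasDerivAt_matrix_iff {α : ℝ → Matrix ι ι 𝕜} {V : Matrix ι ι 𝕜} {s : ℝ} :
    HasDerivAt α V s ↔ ∀ i j, HasDerivAt (fun u => α u i j) (V i j) s := by
  refine ⟨fun h i j => (entryCLM (𝕜 := 𝕜) i j).hasFDerivAt.comp_hasDerivAt s h, fun h => ?_⟩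
  have e : α = fun u => ∑ i, ∑ j, α u i j • (Matrix.single i j 1 : Matrix ι ι 𝕜) :=
    funext fun u => matrix_eq_sum_entry_smul _
  rw [e, matrix_eq_sum_entry_smul V]
  exact HasDerivAt.fun_sum fun i _ => HasDerivAt.fun_sum fun j _ => (h i j).smul_const _

theorem continuousOn_matrix_iff {α : ℝ → Matrix ι ι 𝕜} {S : Set ℝ} :
    ContinuousOn α S ↔ ∀ i j, ContinuousOn (fun u => α u i j) S := by
  refine ⟨fun h i j => (entryCLM i j).continuous.comp_continuousOn h, fun h => ?_⟩
  have e : α = fun u => ∑ i, ∑ j, α u i j • (Matrix.single i j 1 : Matrix ι ι 𝕜) :=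
    funext fun u => matrix_eq_sum_entry_smul _
  rw [e]
  exact continuousOn_finsetSum _ fun i _ => continuousOn_finsetSum _ fun j _ =>
    (h i j).smul continuousOn_const

theorem continuousOn_inv_posDef :
    ContinuousOn (fun X : Matrix ι ι 𝕜 => X⁻¹) {X | X.PosDef} := fun X hX => by
  have : CompleteSpace (Matrix ι ι 𝕜) := FiniteDimensional.complete ℝ _
  obtain ⟨u, rfl⟩ := Matrix.PosDef.isUnit hX
  have h := NormedRing.inverse_continuousAt u
  have e : (fun X : Matrix ι ι 𝕜 => X⁻¹) = Ring.inverse :=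
    funext fun X => Matrix.nonsing_inv_eq_ringInverse X
  rw [e]
  exact h.continuousWithinAt

/-- The integrand of `pathLength`. -/
def speed (α : ℝ → Matrix ι ι 𝕜) (s : ℝ) : ℝ :=
  ‖mpow (α s) (-1 / 2) * velocity α s * mpow (α s) (-1 / 2)‖

theorem hasDerivAt_velocity {α : ℝ → Matrix ι ι 𝕜} {c d s : ℝ}
    (hα : ∀ i j, ContDiffOn ℝ ∞ (fun u => α u i j) (Set.Icc c d)) (hs : s ∈ Set.Ioo c d) :
    HasDerivAt α (velocity α s) s :=
  hasDerivAt_matrix_iff.2 fun i j => by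
    have h : DifferentiableAt ℝ (fun u => α u i j) s :=
      ((hα i j).differentiableOn (by simp) s (Set.Ioo_subset_Icc_self hs)).differentiableAt
        (Icc_mem_nhds hs.1 hs.2)
    exact h.hasDerivAt

theorem integrableOn_speed {α : ℝ → Matrix ι ι 𝕜} {c d : ℝ} (hcd : c < d)
    (hpos : ∀ s ∈ Set.Icc c d, (α s).PosDef)
    (hα : ∀ i j, ContDiffOn ℝ ∞ (fun u => α u i j) (Set.Icc c d)) :
    MeasureTheory.IntegrableOn (speed α) (Set.Icc c d) := by
  -- At the endpoints `velocity` may depend on the neighbouring pieces. The one-sided derivative is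
  -- continuous on the closed piece and agrees with it in the interior.
  set V : ℝ → Matrix ι ι 𝕜 := fun s =>
    Matrix.of fun i j => derivWithin (fun u => α u i j) (Set.Icc c d) s with hV
  have hVc : ContinuousOn V (Set.Icc c d) := continuousOn_matrix_iff.2 fun i j =>
    (hα i j).continuousOn_derivWithin (uniqueDiffOn_Icc hcd) (by simp)
  have hαc : ContinuousOn α (Set.Icc c d) := continuousOn_matrix_iff.2 fun i j =>
    (hα i j).continuousOn
  have hinv : ContinuousOn (fun s => (α s)⁻¹) (Set.Icc c d) :=
    continuousOn_inv_posDef.comp hαc hpos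
  have htr : Continuous fun Q : Matrix ι ι 𝕜 => RCLike.re Q.trace := by
    have : (fun Q : Matrix ι ι 𝕜 => RCLike.re Q.trace) = reTraceMul 1 := by
      ext Q; rw [reTraceMul_apply, Matrix.one_mul]
    rw [this]; exact (reTraceMul _).continuous
  have hVH : ContinuousOn (fun s => (V s)ᴴ) (Set.Icc c d) := hVc.star
  have hc : ContinuousOn (fun s => √(RCLike.re ((α s)⁻¹ * (V s)ᴴ * (α s)⁻¹ * V s).trace))
      (Set.Icc c d) :=
    (htr.comp_continuousOn (((hinv.mul hVH).mul hinv).mul hVc)).sqrt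
  have hint := hc.integrableOn_Icc (μ := MeasureTheory.volume)
  rw [integrableOn_Icc_iff_integrableOn_Ioo] at hint ⊢
  refine hint.congr_fun (fun s hs => ?_) measurableSet_Ioo
  have hVs : V s = velocity α s := by
    ext i j
    exact derivWithin_of_mem_nhds (Icc_mem_nhds hs.1 hs.2)
  simp only
  rw [hVs, ← norm_mpow_mul_mul_mpow_sq (hpos s (Set.Ioo_subset_Icc_self hs)),
    Real.sqrt_sq (norm_nonneg _), speed]

theorem logDist_sub_le_integral_of_contDiffOn {A : Matrix ι ι 𝕜} (hA : A.PosDef)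
    {α : ℝ → Matrix ι ι 𝕜} {c d : ℝ} (hcd : c < d) (hpos : ∀ s ∈ Set.Icc c d, (α s).PosDef)
    (hα : ∀ i j, ContDiffOn ℝ ∞ (fun u => α u i j) (Set.Icc c d)) :
    logDist A (α d) - logDist A (α c) ≤ ∫ s in c..d, speed α s := by
  have hW := posDef_mpow hA (-1 / 2)
  set W := mpow A (-1 / 2) with hWdef
  set g : ℝ → ℝ := fun s => ‖mlog (W * α s * W)‖ ^ 2 with hg
  have hαc : ContinuousOn α (Set.Icc c d) := continuousOn_matrix_iff.2 fun i j =>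
    (hα i j).continuousOn
  have hgc : ContinuousOn g (Set.Icc c d) :=
    continuousOn_norm_mlog_sq.comp ((continuousOn_const.mul hαc).mul continuousOn_const)
      fun s hs => hW.conj_posDef (hpos s hs)
  have hsqrt : ∀ s, √(g s) = logDist A (α s) := fun s => Real.sqrt_sq (norm_nonneg _)
  -- The square root is not differentiable at 0, where the path meets A; η > 0 smooths it and tends
  -- to 0 afterwards.
  have key : ∀ η : ℝ, 0 < η → √(g d + η) - √(g c + η) ≤ ∫ s in c..d, speed α s := fun η hη => by
    refine intervalIntegral.sub_le_integral_of_hasDeriv_right_of_le hcd.le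
      (g := fun s => √(g s + η))
      (g' := fun s => RCLike.re (cfc (fun x => 2 * Real.log x / x) (W * α s * W) *
        (W * velocity α s * W)).trace / (2 * √(g s + η)))
      (hgc.add continuousOn_const).sqrt (fun s hs => ?_) (integrableOn_speed hcd hpos hα)
      (fun s hs => ?_)
    · have h1 : HasDerivAt (fun s => W * α s * W) (W * velocity α s * W) s :=
        ((hasDerivAt_velocity hα hs).const_mul W).mul_const W
      have h2 := hasDerivAt_norm_mlog_sq h1 (hW.conj_posDef (hpos s (Set.Ioo_subset_Icc_self hs)))
        (by
          filter_upwards [Icc_mem_nhds hs.1 hs.2] with t ht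
          exact (hW.conj_posDef (hpos t ht)).1)
      have h3 := (h2.add_const η).sqrt (by positivity)
      exact h3.hasDerivWithinAt
    · have hs' := Set.Ioo_subset_Icc_self hs
      have hX := hW.conj_posDef (hpos s hs')
      have h1 := re_trace_cfc_mul_le hX (W * velocity α s * W)
      rw [norm_mpow_conj_mul_mul_mpow_conj hW (hpos s hs')] at h1
      have h2 : ‖mlog (W * α s * W)‖ ≤ √(g s + η) :=
        Real.le_sqrt_of_sq_le (by simp only [hg]; linarith)
      have h3 : 0 < √(g s + η) := Real.sqrt_pos.2 (by positivity)
      rw [div_le_iff₀ (by positivity)]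
      refine h1.trans ?_
      rw [← speed]
      have := mul_le_mul_of_nonneg_right h2 (norm_nonneg
        (mpow (α s) (-1 / 2) * velocity α s * mpow (α s) (-1 / 2)))
      rw [← speed] at this
      linarith
  rw [← hsqrt, ← hsqrt]
  have hlim : Filter.Tendsto (fun η => √(g d + η) - √(g c + η)) (nhdsWithin 0 (Set.Ioi 0))
      (nhds (√(g d) - √(g c))) := by
    have : Continuous fun η => √(g d + η) - √(g c + η) := by fun_prop
    have h := this.tendsto 0
    rw [add_zero, add_zero] at h
    exact h.mono_left nhdsWithin_le_nhds
  refine le_of_tendsto hlim ?_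
  filter_upwards [self_mem_nhdsWithin] with η hη
  exact key η hη

theorem logDist_sub_le_pathLength {A : Matrix ι ι 𝕜} (hA : A.PosDef) {α : ℝ → Matrix ι ι 𝕜}
    {a b : ℝ} (h : IsPiecewiseSmoothPath α a b) :
    logDist A (α b) - logDist A (α a) ≤ pathLength α a b := by
  obtain ⟨-, hpos, k, t, ht, rfl, rfl, hα⟩ := h
  have hle : ∀ l : Fin k, ∀ s ∈ Set.Icc (t l.castSucc) (t l.succ), (α s).PosDef :=
    fun l s hs => hpos s ⟨(ht.monotone (Fin.zero_le _)).trans hs.1,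
      hs.2.trans (ht.monotone (Fin.le_last _))⟩
  have key : ∀ i : Fin (k + 1),
      IntervalIntegrable (speed α) MeasureTheory.volume (t 0) (t i) ∧
      logDist A (α (t i)) - logDist A (α (t 0)) ≤ ∫ s in (t 0)..(t i), speed α s := fun i => by
    induction i using Fin.induction with
    | zero => simp
    | succ l ih =>
      have hl : t l.castSucc < t l.succ := ht (Fin.castSucc_lt_succ)
      have h1 : IntervalIntegrable (speed α) MeasureTheory.volume (t l.castSucc) (t l.succ) :=
        (intervalIntegrable_iff_integrableOn_Icc_of_le hl.le).2
          (integrableOn_speed hl (hle l) (hα l))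
      have h2 := logDist_sub_le_integral_of_contDiffOn hA hl (hle l) (hα l)
      refine ⟨ih.1.trans h1, ?_⟩
      rw [← intervalIntegral.integral_add_adjacent_intervals ih.1 h1]
      linarith [ih.2]
  exact (key (Fin.last k)).2

theorem contDiff_mpow {M : Matrix ι ι 𝕜} (hM : M.PosDef) : ContDiff ℝ ∞ fun t => mpow M t := by
  have h : (fun t => mpow M t) = fun t => ∑ i,
      (Real.exp (Real.log (hM.1.eigenvalues i) * t)) •
      ((hM.1.eigenvectorUnitary : Matrix ι ι 𝕜) *
      Matrix.single i i 1 * (hM.1.eigenvectorUnitary : Matrix ι ι 𝕜)ᴴ) :=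
    funext fun t => by
      rw [mpow, cfc_eq_sum_smul hM.1]
      simp only [Real.rpow_def_of_pos (hM.eigenvalues_pos _)]
  rw [h]
  exact ContDiff.sum fun i _ => by fun_prop

theorem isPiecewiseSmoothPath_geodesic {A B : Matrix ι ι 𝕜} (hA : A.PosDef) (hB : B.PosDef) :
    IsPiecewiseSmoothPath (geodesic A B) 0 1 := by
  refine ⟨one_pos, fun s _ => posDef_geodesic hA hB s, 1, fun i => (i : ℝ), ?_, by simp, by simp,
    fun l i j => ?_⟩
  · intro i j hij
    exact Nat.cast_lt.2 hij
  · have h : ContDiff ℝ ∞ (geodesic A B) :=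
      (contDiff_const.mul (contDiff_mpow (posDef_whiten hA hB))).mul contDiff_const
    exact ((entryCLM i j).contDiff.comp h).contDiffOn

theorem pathLength_geodesic {A B : Matrix ι ι 𝕜} (hA : A.PosDef) (hB : B.PosDef) :
    pathLength (geodesic A B) 0 1 = logDist A B := by
  have hP := posDef_whiten hA hB
  set P := mpow A (-1 / 2) * B * mpow A (-1 / 2) with hPdef
  have hspeed : ∀ s, ‖mpow (geodesic A B s) (-1 / 2) * velocity (geodesic A B) s *
      mpow (geodesic A B s) (-1 / 2)‖ = logDist A B := fun s => by
    have hd : HasDerivAt (geodesic A B)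
        (mpow A (1 / 2) * (mlog P * mpow P s) * mpow A (1 / 2)) s :=
      ((hasDerivAt_mpow hP s).const_mul _).mul_const _
    have hv : velocity (geodesic A B) s =
        mpow A (1 / 2) * (mlog P * mpow P s) * mpow A (1 / 2) := by
      ext i j
      exact (hasDerivAt_matrix_iff.1 hd i j).deriv
    rw [hv, geodesic, norm_mpow_conj_mul_mul_mpow_conj (posDef_mpow hA _) (posDef_mpow hP s),
      mpow_mpow hP, ← Matrix.mul_assoc, ← mlog_mul_mpow_comm, Matrix.mul_assoc, Matrix.mul_assoc,
      mpow_mul_mpow hP, mpow_mul_mpow hP]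
    ring_nf
    rw [mpow_zero hP, Matrix.mul_one, logDist]
  rw [pathLength]
  simp only [hspeed]
  simp

theorem rdist_eq_logDist {A B : Matrix ι ι 𝕜} (hA : A.PosDef) (hB : B.PosDef) :
    rdist A B = logDist A B := by
  refine IsLeast.csInf_eq ⟨⟨geodesic A B, 0, 1, isPiecewiseSmoothPath_geodesic hA hB,
    geodesic_zero hA hB, geodesic_one hA hB, (pathLength_geodesic hA hB).symm⟩, ?_⟩
  rintro l ⟨α, a, b, hα, rfl, rfl, rfl⟩
  have := logDist_sub_le_pathLength hA hα
  rwa [logDist_self hA, sub_zero] at this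

theorem logDist_triangle {A B C : Matrix ι ι 𝕜} (hA : A.PosDef) (hB : B.PosDef) (hC : C.PosDef) :
    logDist A C ≤ logDist A B + logDist B C := by
  have h := logDist_sub_le_pathLength hA (isPiecewiseSmoothPath_geodesic hB hC)
  rw [pathLength_geodesic hB hC, geodesic_zero hB hC, geodesic_one hB hC] at h
  linarith

/-! ### Compactness of balls and comparison with the matrix topology -/

theorem abs_log_eigenvalues_le {X : Matrix ι ι 𝕜} (hX : X.IsHermitian) (i : ι) :
    |Real.log (hX.eigenvalues i)| ≤ ‖mlog X‖ := by
  refine abs_le_of_sq_le_sq ?_ (norm_nonneg _)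
  rw [mlog, norm_cfc_sq hX]
  exact Finset.single_le_sum (f := fun i => Real.log (hX.eigenvalues i) ^ 2)
    (fun i _ => sq_nonneg _) (Finset.mem_univ i)

theorem exp_neg_norm_mlog_le_eigenvalues {X : Matrix ι ι 𝕜} (hX : X.PosDef) (i : ι) :
    Real.exp (-‖mlog X‖) ≤ hX.1.eigenvalues i := by
  rw [← Real.le_log_iff_exp_le (hX.eigenvalues_pos i)]
  exact (abs_le.1 (abs_log_eigenvalues_le hX.1 i)).1

theorem eigenvalues_le_exp_norm_mlog {X : Matrix ι ι 𝕜} (hX : X.PosDef) (i : ι) :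
    hX.1.eigenvalues i ≤ Real.exp ‖mlog X‖ := by
  rw [← Real.log_le_iff_le_exp (hX.eigenvalues_pos i)]
  exact (abs_le.1 (abs_log_eigenvalues_le hX.1 i)).2

theorem norm_sub_one_sq_le {X : Matrix ι ι 𝕜} (hX : X.PosDef) :
    ‖X - 1‖ ^ 2 ≤ Fintype.card ι * (Real.exp ‖mlog X‖ - 1) ^ 2 := by
  have e : X - 1 = cfc (fun x : ℝ => x - 1) X := by
    conv_lhs => rw [← cfc_one_fun hX.1]
    nth_rewrite 1 [← cfc_id_fun hX.1]
    rw [cfc_sub_cfc]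
  rw [e, norm_cfc_sq hX.1]
  refine (Finset.sum_le_card_nsmul _ _ ((Real.exp ‖mlog X‖ - 1) ^ 2) fun i _ => ?_).trans
    (by simp)
  have h1 := exp_neg_norm_mlog_le_eigenvalues hX i
  have h2 := eigenvalues_le_exp_norm_mlog hX i
  have h3 := Real.add_one_le_exp ‖mlog X‖
  have h4 := Real.add_one_le_exp (-‖mlog X‖)
  exact sq_le_sq' (by linarith) (by linarith)

theorem isCompact_norm_mlog_le (R : ℝ) :
    IsCompact {X : Matrix ι ι 𝕜 | X.PosDef ∧ ‖mlog X‖ ≤ R} := by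
  have : ProperSpace (Matrix ι ι 𝕜) := FiniteDimensional.proper ℝ _
  refine Metric.isCompact_of_isClosed_isBounded (isClosed_of_closure_subset fun X hX => ?_) ?_
  · have hH : X.IsHermitian := by
      have hcl : IsClosed {X : Matrix ι ι 𝕜 | Xᴴ = X} :=
        isClosed_eq (continuous_id.star) continuous_id
      exact closure_minimal (fun Y hY => hY.1.1) hcl hX
    have hpos : X.PosDef := hH.posDef_iff_eigenvalues_pos.2 fun j => by
      by_contra! hj
      -- Eigenvalues of points of the set are at least exp(-R), so a limit at distance less than
      -- exp(-R) keeps positive eigenvalues.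
      obtain ⟨Y, hY, hXY⟩ := Metric.mem_closure_iff.1 hX (Real.exp (-R)) (Real.exp_pos _)
      obtain ⟨i, hi⟩ := exists_eigenvalue_near hY.1.1 hH j
      rw [dist_eq_norm] at hXY
      have h1 := exp_neg_norm_mlog_le_eigenvalues hY.1 i
      have h2 := Real.exp_le_exp.2 (neg_le_neg hY.2)
      have h3 := (abs_le.1 hi).1
      linarith
    refine ⟨hpos, ?_⟩
    have hne := mem_closure_iff_nhdsWithin_neBot.1 hX
    have hsub : {X : Matrix ι ι 𝕜 | X.PosDef ∧ ‖mlog X‖ ≤ R} ⊆ {X | X.PosDef} := fun Y hY => hY.1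
    have hc := ((continuousOn_norm_mlog_sq X hpos).mono hsub).sqrt
    simp only [Real.sqrt_sq (norm_nonneg _)] at hc
    refine @le_of_tendsto _ _ _ _ _ _ _ _ _ hne hc ?_
    filter_upwards [self_mem_nhdsWithin] with Y hY
    exact hY.2
  · refine (Metric.isBounded_closedBall (x := (1 : Matrix ι ι 𝕜))
      (r := √(Fintype.card ι * (Real.exp R - 1) ^ 2))).subset fun X hX => ?_
    rw [Metric.mem_closedBall, dist_eq_norm]
    refine Real.le_sqrt_of_sq_le ((norm_sub_one_sq_le hX.1).trans ?_)
    have h1 := Real.add_one_le_exp ‖mlog X‖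
    have h2 := Real.exp_le_exp.2 hX.2
    have h3 := norm_nonneg (mlog X)
    gcongr
    linarith

theorem logDist_one_left (X : Matrix ι ι 𝕜) : logDist 1 X = ‖mlog X‖ := by
  have h1 : mpow (1 : Matrix ι ι 𝕜) (-1 / 2) = 1 := by
    have h := mpow_mpow (Matrix.PosDef.one : (1 : Matrix ι ι 𝕜).PosDef) 0 (-1 / 2)
    rwa [zero_mul, mpow_zero Matrix.PosDef.one] at h
  rw [logDist, h1, Matrix.one_mul, Matrix.mul_one]

theorem continuousOn_logDist {A : Matrix ι ι 𝕜} (hA : A.PosDef) :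
    ContinuousOn (fun C => logDist A C ^ 2) {C : Matrix ι ι 𝕜 | C.PosDef} :=
  continuousOn_norm_mlog_sq.comp
    ((continuousOn_const.mul continuousOn_id).mul continuousOn_const)
    fun _ hC => posDef_whiten hA hC

/-- After whitening by G the limit is the identity, near which ‖X - 1‖ is controlled by exp ‖log X‖
- 1. -/
theorem tendsto_of_tendsto_logDist {G : Matrix ι ι 𝕜} (hG : G.PosDef) {S : ℕ → Matrix ι ι 𝕜}
    (hS : ∀ n, (S n).PosDef)
    (h : Filter.Tendsto (fun n => logDist G (S n)) Filter.atTop (nhds 0)) :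
    Filter.Tendsto S Filter.atTop (nhds G) := by
  have hY : Filter.Tendsto (fun n => mpow G (-1 / 2) * S n * mpow G (-1 / 2)) Filter.atTop
      (nhds 1) := by
    refine tendsto_iff_norm_sub_tendsto_zero.2 ?_
    have hc : Continuous fun r : ℝ => √(Fintype.card ι * (Real.exp r - 1) ^ 2) := by fun_prop
    have hlim := (hc.tendsto 0).comp h
    simp only [Real.exp_zero, sub_self, ne_eq, OfNat.ofNat_ne_zero, not_false_eq_true, zero_pow,
      mul_zero, Real.sqrt_zero] at hlim
    exact squeeze_zero (fun n => norm_nonneg _) (fun n => Real.le_sqrt_of_sq_le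
      (norm_sub_one_sq_le (posDef_whiten hG (hS n)))) hlim
  have h2 := (hY.const_mul (mpow G (1 / 2))).mul_const (mpow G (1 / 2))
  rw [Matrix.mul_one, mpow_half_mul_mpow_half hG] at h2
  exact h2.congr fun n => unwhiten hG _

/-! ### The least squares mean -/

section

variable {m : ℕ} {A : Fin m → Matrix ι ι 𝕜}

theorem exists_isMin_sum_logDist_sq (hm : 0 < m) (hA : ∀ i, (A i).PosDef) :
    ∃ G : Matrix ι ι 𝕜, G.PosDef ∧ ∀ C : Matrix ι ι 𝕜, C.PosDef →
      ∑ j, logDist (A j) G ^ 2 ≤ ∑ j, logDist (A j) C ^ 2 := by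
  set F : Matrix ι ι 𝕜 → ℝ := fun C => ∑ j, logDist (A j) C ^ 2 with hF
  set z : Fin m := ⟨0, hm⟩
  -- Outside this ball about 1 the single term δ²(A_z, C) already exceeds the value of the sum at
  -- A_z.
  set R := ‖mlog (A z)‖ + √(F (A z)) with hR
  have hFc : ContinuousOn F {X | X.PosDef ∧ ‖mlog X‖ ≤ R} :=
    continuousOn_finsetSum _ fun j _ => (continuousOn_logDist (hA j)).mono fun X hX => hX.1
  have hz : A z ∈ {X : Matrix ι ι 𝕜 | X.PosDef ∧ ‖mlog X‖ ≤ R} :=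
    ⟨hA z, le_add_of_nonneg_right (Real.sqrt_nonneg _)⟩
  obtain ⟨G, hG, hmin⟩ := (isCompact_norm_mlog_le R).exists_isMinOn ⟨_, hz⟩ hFc
  refine ⟨G, hG.1, fun C hC => ?_⟩
  by_cases hCR : ‖mlog C‖ ≤ R
  · exact hmin ⟨hC, hCR⟩
  · refine (hmin hz).trans ?_
    have h1 := logDist_triangle Matrix.PosDef.one (hA z) hC
    rw [logDist_one_left, logDist_one_left] at h1
    have h2 : √(F (A z)) ≤ logDist (A z) C := by linarith [not_le.1 hCR]
    have h3 : F (A z) ≤ logDist (A z) C ^ 2 := (Real.sqrt_le_left (logDist_nonneg _ _)).1 h2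
    exact h3.trans (Finset.single_le_sum (f := fun j => logDist (A j) C ^ 2)
      (fun j _ => sq_nonneg _) (Finset.mem_univ z))

/-- The variance inequality for a minimizer of the sum of the squared distances. -/
theorem sum_logDist_sq_add_le (hA : ∀ i, (A i).PosDef) {G C : Matrix ι ι 𝕜} (hG : G.PosDef)
    (hmin : ∀ C : Matrix ι ι 𝕜, C.PosDef →
      ∑ j, logDist (A j) G ^ 2 ≤ ∑ j, logDist (A j) C ^ 2) (hC : C.PosDef) :
    ∑ j, logDist (A j) G ^ 2 + m * logDist G C ^ 2 ≤ ∑ j, logDist (A j) C ^ 2 := by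
  set x := m * logDist G C ^ 2 with hx
  set y := ∑ j, logDist (A j) C ^ 2 - ∑ j, logDist (A j) G ^ 2 with hy
  -- Minimality of G is compared with the point at time t on the geodesic to C, and t is divided
  -- out; small t gives the claim.
  have key : ∀ t : ℝ, 0 < t → t ≤ 1 → (1 - t) * x ≤ y := fun t ht0 ht1 => by
    have h1 := hmin _ (posDef_geodesic hG hC t)
    have h2 : ∑ j, logDist (A j) (geodesic G C t) ^ 2 ≤
        ∑ j, ((1 - t) * logDist (A j) G ^ 2 + t * logDist (A j) C ^ 2 -
          t * (1 - t) * logDist G C ^ 2) := Finset.sum_le_sum fun j _ => by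
      have := logDist_geodesic_sq_le hG hC (hA j) ht0.le ht1
      rwa [logDist_comm (posDef_geodesic hG hC t) (hA j), logDist_comm hG (hA j),
        logDist_comm hC (hA j)] at this
    rw [Finset.sum_sub_distrib, Finset.sum_add_distrib, ← Finset.mul_sum, ← Finset.mul_sum,
      Finset.sum_const, Finset.card_univ, Fintype.card_fin, nsmul_eq_mul] at h2
    have h3 : t * ((1 - t) * x) ≤ t * y := by rw [hx, hy]; linarith
    exact le_of_mul_le_mul_left h3 ht0
  have hxy : x ≤ y := by
    by_contra! h
    have hy0 : 0 ≤ y := by simpa using key 1 one_pos le_rfl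
    have hx0 : 0 < x := hy0.trans_lt h
    -- This t makes (1 - t)x the midpoint of x and y, which exceeds y.
    have := key ((x - y) / (2 * x)) (div_pos (sub_pos.2 h) (by positivity))
      ((div_le_one (by positivity)).2 (by linarith))
    have e : (1 - (x - y) / (2 * x)) * x = (x + y) / 2 := by field_simp; ring
    linarith
  linarith

end

/-! ### Deterministic walks in metric spaces with a semiparallelogram law -/

section

variable {P : Type*} [PseudoMetricSpace P]

/-- `S 1, S 2, …` are inductive means of `a 0, a 1, …` along geodesics that satisfy the
semiparallelogram law. -/
structure IsWalk (a S : ℕ → P) : Prop where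
  one : S 1 = a 0
  dist_sq_le : ∀ n : ℕ, 1 ≤ n → ∀ z, dist (S (n + 1)) z ^ 2 ≤
    (1 - 1 / ((n : ℝ) + 1)) * dist (S n) z ^ 2 + 1 / ((n : ℝ) + 1) * dist (a n) z ^ 2 -
      1 / ((n : ℝ) + 1) * (1 - 1 / ((n : ℝ) + 1)) * dist (S n) (a n) ^ 2
  dist_succ : ∀ n : ℕ, 1 ≤ n → dist (S n) (S (n + 1)) = 1 / ((n : ℝ) + 1) * dist (S n) (a n)

variable {a S : ℕ → P} {Δ : ℝ}

theorem IsWalk.dist_le (h : IsWalk a S) {z : P} (hz : ∀ i, dist (a i) z ≤ Δ) {n : ℕ}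
    (hn : 1 ≤ n) : dist (S n) z ≤ Δ := by
  have hΔ : 0 ≤ Δ := dist_nonneg.trans (hz 0)
  induction n, hn using Nat.le_induction with
  | base => rw [h.one]; exact hz 0
  | succ n hn ih =>
    refine abs_le_of_sq_le_sq' ?_ hΔ |>.2
    refine (h.dist_sq_le n hn z).trans ?_
    have hn0 : (0 : ℝ) < (n : ℝ) + 1 := by positivity
    set t := 1 / ((n : ℝ) + 1) with ht
    have ht0 : 0 ≤ t := by positivity
    have ht1 : t ≤ 1 := by
      rw [ht, div_le_one hn0]; linarith [Nat.cast_nonneg (α := ℝ) n]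
    have h1 : dist (S n) z ^ 2 ≤ Δ ^ 2 := pow_le_pow_left₀ dist_nonneg ih 2
    have h2 : dist (a n) z ^ 2 ≤ Δ ^ 2 := pow_le_pow_left₀ dist_nonneg (hz n) 2
    nlinarith [mul_nonneg (mul_nonneg ht0 (sub_nonneg.2 ht1)) (sq_nonneg (dist (S n) (a n)))]

theorem IsWalk.succ_mul_dist_sq_le (h : IsWalk a S) (G : P) {n : ℕ} (hn : 1 ≤ n) :
    ((n : ℝ) + 1) * dist (S (n + 1)) G ^ 2 ≤ n * dist (S n) G ^ 2 + dist (a n) G ^ 2 -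
      n / ((n : ℝ) + 1) * dist (S n) (a n) ^ 2 := by
  have hn0 : (0 : ℝ) < (n : ℝ) + 1 := by positivity
  refine (mul_le_mul_of_nonneg_left (h.dist_sq_le n hn G) hn0.le).trans (le_of_eq ?_)
  field_simp
  ring

theorem IsWalk.mul_dist_sq_le_sum (h : IsWalk a S) (G : P) {n : ℕ} (hn : 1 ≤ n) :
    n * dist (S n) G ^ 2 ≤ ∑ i ∈ Finset.range n, dist (a i) G ^ 2 := by
  induction n, hn using Nat.le_induction with
  | base => simp [h.one]
  | succ n hn ih =>
    have h1 := h.succ_mul_dist_sq_le G hn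
    rw [Finset.sum_range_succ]
    have h2 : 0 ≤ n / ((n : ℝ) + 1) * dist (S n) (a n) ^ 2 := by positivity
    push_cast
    linarith

/-- Each of the j steps moves by at most Δ/(N + 1). -/
theorem IsWalk.dist_add_le (h : IsWalk a S) (hS : ∀ n, 1 ≤ n → ∀ i, dist (S n) (a i) ≤ Δ) {N : ℕ}
    (hN : 1 ≤ N) (j : ℕ) : dist (S N) (S (N + j)) ≤ j * Δ / ((N : ℝ) + 1) := by
  have hΔ : 0 ≤ Δ := dist_nonneg.trans (hS 1 le_rfl 0)
  induction j with
  | zero => simp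
  | succ j ih =>
    refine (dist_triangle _ (S (N + j)) _).trans ?_
    have h1 := h.dist_succ (N + j) (hN.trans (Nat.le_add_right _ _))
    have h2 : dist (S (N + j)) (S (N + j + 1)) ≤ 1 / ((N : ℝ) + 1) * Δ := by
      rw [h1]
      push_cast
      gcongr
      · linarith [Nat.cast_nonneg (α := ℝ) j]
      · exact hS _ (hN.trans (Nat.le_add_right _ _)) _
    have e : ((j + 1 : ℕ) : ℝ) * Δ / ((N : ℝ) + 1) =
        j * Δ / ((N : ℝ) + 1) + 1 / ((N : ℝ) + 1) * Δ := by push_cast; ring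
    rw [e]
    exact add_le_add ih h2

/-- Replacing S_{N+j} by S_N costs at most 2Δ times the drift, and the factor (N+j)/(N+j+1) costs at
most Δ²/(N + 1). -/
theorem IsWalk.le_mul_dist_sq (h : IsWalk a S) (hS : ∀ n, 1 ≤ n → ∀ i, dist (S n) (a i) ≤ Δ)
    {N : ℕ} (hN : 1 ≤ N) (j : ℕ) (i : ℕ) :
    dist (a i) (S N) ^ 2 - Δ ^ 2 / ((N : ℝ) + 1) * (2 * j + 1) ≤
      ((N + j : ℕ) : ℝ) / (((N + j : ℕ) : ℝ) + 1) * dist (S (N + j)) (a i) ^ 2 := by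
  have hΔ : 0 ≤ Δ := dist_nonneg.trans (hS 1 le_rfl 0)
  have hNj : 1 ≤ N + j := hN.trans (Nat.le_add_right _ _)
  set x := dist (S (N + j)) (a i) with hx
  set y := dist (a i) (S N) with hy
  have hx0 : 0 ≤ x := dist_nonneg
  have hy0 : 0 ≤ y := dist_nonneg
  have hxΔ : x ≤ Δ := hS _ hNj _
  have hyΔ : y ≤ Δ := by rw [hy, dist_comm]; exact hS _ hN _
  have hd := h.dist_add_le hS hN j
  have htri : y ≤ x + j * Δ / ((N : ℝ) + 1) := by
    have := dist_triangle (S N) (S (N + j)) (a i)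
    rw [dist_comm (S N) (a i)] at this
    linarith
  have hN0 : (0 : ℝ) < (N : ℝ) + 1 := by positivity
  set q := (1 : ℝ) / ((N : ℝ) + 1) with hq
  have hq0 : 0 ≤ q := by positivity
  have e1 : (j : ℝ) * Δ / ((N : ℝ) + 1) = j * Δ * q := by rw [hq]; ring
  have e2 : Δ ^ 2 / ((N : ℝ) + 1) * (2 * j + 1) = Δ ^ 2 * q * (2 * j) + q * Δ ^ 2 := by
    rw [hq]; ring
  rw [e1] at htri
  rw [e2]
  have hjq : 0 ≤ j * Δ * q := by positivity
  have h1 : y ^ 2 - Δ ^ 2 * q * (2 * j) ≤ x ^ 2 := by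
    have hmul : (y - x) * (y + x) ≤ j * Δ * q * (2 * Δ) := by
      rcases le_total y x with hyx | hyx
      · refine le_trans (mul_nonpos_of_nonpos_of_nonneg (by linarith) (by linarith)) (by positivity)
      · exact mul_le_mul (by linarith) (by linarith) (by linarith) hjq
    nlinarith
  have h2 : (1 : ℝ) / (((N + j : ℕ) : ℝ) + 1) ≤ q := by
    rw [hq]
    push_cast
    gcongr
    linarith [Nat.cast_nonneg (α := ℝ) j]
  have h3 : ((N + j : ℕ) : ℝ) / (((N + j : ℕ) : ℝ) + 1) * x ^ 2 =
      x ^ 2 - 1 / (((N + j : ℕ) : ℝ) + 1) * x ^ 2 := by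
    field_simp
    ring
  have h4 : 1 / (((N + j : ℕ) : ℝ) + 1) * x ^ 2 ≤ q * Δ ^ 2 := by gcongr
  rw [h3]
  linarith

/-- A walk visits the points `A i` in blocks, each block being a permutation of the points, and `G`
satisfies the variance inequality for these points. -/
structure IsBlockWalk {m : ℕ} (A : Fin m → P) (G : P) (a S : ℕ → P) (Δ : ℝ) : Prop extends
    IsWalk a S where
  block : ∀ (k : ℕ) (f : P → ℝ), ∑ j ∈ Finset.range m, f (a (k * m + j)) = ∑ i, f (A i)
  mem : ∀ n, ∃ i, a n = A i
  diam : ∀ i j, dist (A i) (A j) ≤ Δ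
  variance : ∀ z, ∑ i, dist (A i) G ^ 2 + m * dist G z ^ 2 ≤ ∑ i, dist (A i) z ^ 2

variable {m : ℕ} {A : Fin m → P} {G : P}

theorem IsBlockWalk.dist_le_diam (h : IsBlockWalk A G a S Δ) {n : ℕ} (hn : 1 ≤ n) (i : ℕ) :
    dist (S n) (a i) ≤ Δ := by
  refine h.toIsWalk.dist_le (fun j => ?_) hn
  obtain ⟨p, hp⟩ := h.mem j
  obtain ⟨q, hq⟩ := h.mem i
  rw [hp, hq]
  exact h.diam p q

theorem IsBlockWalk.pos (h : IsBlockWalk A G a S Δ) : 0 < m := by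
  obtain ⟨i, -⟩ := h.mem 0
  exact i.pos

/-- The errors 2j + 1 of successive steps add up to a square. -/
theorem IsBlockWalk.add_mul_dist_sq_le (h : IsBlockWalk A G a S Δ) {N : ℕ} (hN : 1 ≤ N) (j : ℕ) :
    ((N : ℝ) + j) * dist (S (N + j)) G ^ 2 ≤ N * dist (S N) G ^ 2 +
      ∑ i ∈ Finset.range j, dist (a (N + i)) G ^ 2 -
      ∑ i ∈ Finset.range j, dist (a (N + i)) (S N) ^ 2 + Δ ^ 2 / ((N : ℝ) + 1) * j ^ 2 := by
  induction j with
  | zero => simp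
  | succ j ih =>
    have h1 := h.toIsWalk.succ_mul_dist_sq_le G (hN.trans (Nat.le_add_right N j))
    have h2 := h.toIsWalk.le_mul_dist_sq (fun n hn i => h.dist_le_diam hn i) hN j (N + j)
    rw [Finset.sum_range_succ, Finset.sum_range_succ]
    have e : Δ ^ 2 / ((N : ℝ) + 1) * ((j + 1 : ℕ) : ℝ) ^ 2 =
        Δ ^ 2 / ((N : ℝ) + 1) * j ^ 2 + Δ ^ 2 / ((N : ℝ) + 1) * (2 * j + 1) := by
      push_cast; ring
    rw [e, ← add_assoc N j 1]
    push_cast at h1 h2 ⊢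
    linarith

/-- Over a full block the two sums run over all A_i, and the variance inequality at S_{km} bounds
their difference by -m δ²(S_{km}, G). This lowers the coefficient from k to k - 1. -/
theorem IsBlockWalk.succ_block (h : IsBlockWalk A G a S Δ) {k : ℕ} (hk : 1 ≤ k) :
    ((k : ℝ) + 1) * dist (S ((k + 1) * m)) G ^ 2 ≤
      ((k : ℝ) - 1) * dist (S (k * m)) G ^ 2 + Δ ^ 2 / k := by
  have hm := h.pos
  have hm0 : (0 : ℝ) < m := Nat.cast_pos.2 hm
  have hk0 : (0 : ℝ) < k := Nat.cast_pos.2 hk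
  have h1 := h.add_mul_dist_sq_le (Nat.mul_pos hk hm) m
  rw [h.block k fun x => dist x G ^ 2, h.block k fun x => dist x (S (k * m)) ^ 2] at h1
  have h2 := h.variance (S (k * m))
  rw [dist_comm G] at h2
  have e : (k + 1) * m = k * m + m := by ring
  rw [e]
  have h3 : Δ ^ 2 / (((k * m : ℕ) : ℝ) + 1) * m ^ 2 ≤ m * (Δ ^ 2 / k) := by
    push_cast
    rw [div_mul_eq_mul_div, mul_div_assoc', div_le_div_iff₀ (by positivity) hk0]
    nlinarith [mul_nonneg hm0.le (sq_nonneg Δ)]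
  refine le_of_mul_le_mul_left ?_ hm0
  push_cast at h1 h3
  linarith

/-- Multiplying the block recursion by k makes it telescope, each block adding Δ². -/
theorem IsBlockWalk.mul_sub_one_mul_dist_sq_le (h : IsBlockWalk A G a S Δ) {k : ℕ} (hk : 1 ≤ k) :
    k * ((k : ℝ) - 1) * dist (S (k * m)) G ^ 2 ≤ ((k : ℝ) - 1) * Δ ^ 2 := by
  induction k, hk using Nat.le_induction with
  | base => simp
  | succ k hk ih =>
    have hk0 : (0 : ℝ) < k := Nat.cast_pos.2 hk
    have h1 := mul_le_mul_of_nonneg_left (h.succ_block hk) hk0.le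
    have e : (k : ℝ) * (((k : ℝ) - 1) * dist (S (k * m)) G ^ 2 + Δ ^ 2 / k) =
      k * ((k : ℝ) - 1) * dist (S (k * m)) G ^ 2 + Δ ^ 2 := by field_simp
    rw [e] at h1
    push_cast
    linarith

theorem IsBlockWalk.mul_dist_sq_le (h : IsBlockWalk A G a S Δ) {k : ℕ} (hk : 1 ≤ k) :
    k * dist (S (k * m)) G ^ 2 ≤ 1 / (m : ℝ) * ∑ i, dist (A i) G ^ 2 + Δ ^ 2 := by
  have hm0 : (0 : ℝ) < m := Nat.cast_pos.2 h.pos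
  have hα : 0 ≤ 1 / (m : ℝ) * ∑ i, dist (A i) G ^ 2 := by positivity
  -- The telescoped bound is void at k = 1; there the averaged bound gives α. Only this case needs
  -- α.
  rcases hk.eq_or_lt with rfl | hk2
  · have h1 := h.toIsWalk.mul_dist_sq_le_sum G h.pos
    have h2 := h.block 0 fun x => dist x G ^ 2
    simp only [zero_mul, zero_add] at h2
    rw [h2] at h1
    have h3 : dist (S m) G ^ 2 ≤ 1 / (m : ℝ) * ∑ i, dist (A i) G ^ 2 := by
      rw [one_div, ← div_eq_inv_mul, le_div_iff₀ hm0]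
      linarith
    rw [one_mul]
    push_cast
    nlinarith [sq_nonneg Δ]
  · have hk' : (0 : ℝ) < (k : ℝ) - 1 := by
      have : (1 : ℝ) < k := by exact_mod_cast hk2
      linarith
    have h1 := h.mul_sub_one_mul_dist_sq_le hk
    have h2 : k * dist (S (k * m)) G ^ 2 ≤ Δ ^ 2 := by
      refine le_of_mul_le_mul_left ?_ hk'
      linarith
    linarith

theorem IsBlockWalk.dist_sq_le_div (h : IsBlockWalk A G a S Δ) {n : ℕ} (hn : 1 ≤ n) :
    dist (S n) G ^ 2 ≤ (4 * m * (1 / (m : ℝ) * ∑ i, dist (A i) G ^ 2 + 2 * Δ ^ 2)) / n := by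
  have hm := h.pos
  have hm0 : (0 : ℝ) < m := Nat.cast_pos.2 hm
  have hn0 : (0 : ℝ) < n := Nat.cast_pos.2 hn
  rw [le_div_iff₀ hn0]
  set α := 1 / (m : ℝ) * ∑ i, dist (A i) G ^ 2 with hα
  have hα0 : 0 ≤ α := by positivity
  have hnk : n = n / m * m + n % m := (Nat.div_add_mod' n m).symm
  have hj : n % m < m := Nat.mod_lt _ hm
  set k := n / m with hkdef
  set j := n % m
  -- Inside the first block the averaged bound suffices. Later, n is compared with the last
  -- completed block, from which the walk has drifted at most Δ/k, and n ≤ 2mk.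
  rcases Nat.eq_zero_or_pos k with hk | hk
  · have h1 := h.toIsWalk.mul_dist_sq_le_sum G hn
    have h2 := h.block 0 fun x => dist x G ^ 2
    simp only [zero_mul, zero_add] at h2
    have hnm : n ≤ m := by rw [hnk, hk]; omega
    have h3 : ∑ i ∈ Finset.range n, dist (a i) G ^ 2 ≤ ∑ i ∈ Finset.range m, dist (a i) G ^ 2 :=
      Finset.sum_le_sum_of_subset_of_nonneg (Finset.range_mono hnm) fun _ _ _ => sq_nonneg _
    have h4 : ∑ i, dist (A i) G ^ 2 = m * α := by rw [hα]; field_simp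
    rw [h2, h4] at h3
    nlinarith [mul_nonneg hm0.le hα0, mul_nonneg hm0.le (sq_nonneg Δ)]
  · have hk0 : (0 : ℝ) < k := Nat.cast_pos.2 hk
    have hk1 : (1 : ℝ) ≤ k := by exact_mod_cast hk
    have hΔ : 0 ≤ Δ := dist_nonneg.trans (h.dist_le_diam le_rfl 0)
    have h1 := h.mul_dist_sq_le hk
    have h2 := h.toIsWalk.dist_add_le (fun n hn i => h.dist_le_diam hn i) (Nat.mul_pos hk hm) j
    rw [← hnk] at h2
    have h3 : j * Δ / (((k * m : ℕ) : ℝ) + 1) ≤ Δ / k := by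
      rw [div_le_div_iff₀ (by positivity) hk0]
      have hjm : (j : ℝ) ≤ m := by exact_mod_cast hj.le
      push_cast
      nlinarith [mul_le_mul_of_nonneg_right hjm (mul_nonneg hΔ hk0.le)]
    have h4 : dist (S n) G ≤ dist (S (k * m)) G + Δ / k := by
      have := dist_triangle (S n) (S (k * m)) G
      rw [dist_comm (S n) (S (k * m))] at this
      linarith
    set D := dist (S (k * m)) G with hD
    have h5 : dist (S n) G ^ 2 ≤ 2 * D ^ 2 + 2 * (Δ / k) ^ 2 :=
      (pow_le_pow_left₀ dist_nonneg h4 2).trans (by nlinarith [sq_nonneg (D - Δ / k)])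
    have h6 : k * (Δ / k) ^ 2 ≤ Δ ^ 2 := by
      have : k * (Δ / k) ^ 2 = Δ ^ 2 / k := by field_simp
      rw [this]
      exact div_le_self (sq_nonneg _) hk1
    have h7 : k * dist (S n) G ^ 2 ≤ 2 * (α + 2 * Δ ^ 2) := by
      nlinarith [mul_le_mul_of_nonneg_left h5 hk0.le]
    have h8 : (n : ℝ) ≤ 2 * m * k := by
      have : n ≤ 2 * m * k := by
        have : m ≤ m * k := Nat.le_mul_of_pos_right m hk
        nlinarith
      exact_mod_cast this
    calc dist (S n) G ^ 2 * n ≤ dist (S n) G ^ 2 * (2 * m * k) := by gcongr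
      _ = 2 * m * (k * dist (S n) G ^ 2) := by ring
      _ ≤ 2 * m * (2 * (α + 2 * Δ ^ 2)) := by gcongr
      _ = _ := by ring

end

/-! ### The cone of positive definite matrices as a metric space -/

/-- The cone of positive definite matrices, to carry the trace Riemannian metric. -/
def PosDefCone (𝕜 ι : Type*) [RCLike 𝕜] [Fintype ι] : Type _ := {X : Matrix ι ι 𝕜 // X.PosDef}

/-- A positive definite matrix as a point of the cone. -/
def PosDefCone.mk (X : Matrix ι ι 𝕜) (hX : X.PosDef) : PosDefCone 𝕜 ι := ⟨X, hX⟩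

/-- The cone is a separate `def`, so that this metric does not compete with the Frobenius metric of
the subtype. -/
instance : MetricSpace (PosDefCone 𝕜 ι) where
  dist X Y := logDist X.1 Y.1
  dist_self X := logDist_self X.2
  dist_comm X Y := logDist_comm X.2 Y.2
  dist_triangle X Y Z := logDist_triangle X.2 Y.2 Z.2
  eq_of_dist_eq_zero {X Y} h := Subtype.ext (eq_of_logDist_eq_zero X.2 Y.2 h)

theorem dist_mk_mk {X Y : Matrix ι ι 𝕜} (hX : X.PosDef) (hY : Y.PosDef) :
    dist (PosDefCone.mk X hX) (PosDefCone.mk Y hY) = rdist X Y :=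
  (rdist_eq_logDist hX hY).symm

theorem posDef_inductiveMean {a : ℕ → Matrix ι ι 𝕜} (ha : ∀ n, (a n).PosDef) (n : ℕ) :
    (inductiveMean a n).PosDef := by
  induction n with
  | zero => exact ha 0
  | succ n ih =>
    cases n with
    | zero => exact ha 0
    | succ n => exact posDef_geodesic ih (ha _) _

theorem inductiveMean_succ (a : ℕ → Matrix ι ι 𝕜) {n : ℕ} (hn : 1 ≤ n) :
    inductiveMean a (n + 1) = geodesic (inductiveMean a n) (a n) (1 / ((n : ℝ) + 1)) := by
  obtain ⟨n, rfl⟩ := Nat.exists_eq_add_of_le' hn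
  rw [inductiveMean]
  push_cast
  ring_nf

theorem isWalk_inductiveMean {a : ℕ → Matrix ι ι 𝕜} (ha : ∀ n, (a n).PosDef) :
    IsWalk (fun n => PosDefCone.mk (a n) (ha n))
      (fun n => PosDefCone.mk (inductiveMean a n) (posDef_inductiveMean ha n)) where
  one := rfl
  dist_sq_le n hn z := by
    have ht : 1 / ((n : ℝ) + 1) ≤ 1 := by
      rw [div_le_one (by positivity)]; linarith [Nat.cast_nonneg (α := ℝ) n]
    have h := logDist_geodesic_sq_le (posDef_inductiveMean ha n) (ha n) z.2
      (by positivity : 0 ≤ 1 / ((n : ℝ) + 1)) ht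
    rw [← inductiveMean_succ a hn] at h
    exact h
  dist_succ n hn := by
    have h := logDist_geodesic_right (posDef_inductiveMean ha n) (ha n)
      (by positivity : 0 ≤ 1 / ((n : ℝ) + 1))
    rw [← inductiveMean_succ a hn] at h
    exact h

section

variable {m : ℕ} [NeZero m] {A : Fin m → Matrix ι ι 𝕜} {G : Matrix ι ι 𝕜}

theorem blockSeq_mul_add (A : Fin m → Matrix ι ι 𝕜) (σ : ℕ → Equiv.Perm (Fin m)) (k : ℕ)
    (j : Fin m) : blockSeq A σ (k * m + j) = A (σ k j) := by
  have h1 : (k * m + j) / m = k := by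
    rw [mul_comm, Nat.mul_add_div (NeZero.pos m), Nat.div_eq_of_lt j.2, add_zero]
  have h2 : Fin.ofNat m (k * m + j) = j := by
    ext
    rw [Fin.val_ofNat, Nat.mul_add_mod', Nat.mod_eq_of_lt j.2]
  rw [blockSeq, h1, h2]

theorem posDef_blockSeq (hA : ∀ i, (A i).PosDef) (σ : ℕ → Equiv.Perm (Fin m)) (n : ℕ) :
    (blockSeq A σ n).PosDef := hA _

theorem rdist_le_diam (A : Fin m → Matrix ι ι 𝕜) (i j : Fin m) : rdist (A i) (A j) ≤ diam A :=
  le_ciSup (f := fun p : Fin m × Fin m => rdist (A p.1) (A p.2))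
    (Set.finite_range _).bddAbove (i, j)

theorem IsLeastSquaresMean.sum_logDist_sq_le (hA : ∀ i, (A i).PosDef)
    (hG : IsLeastSquaresMean A G) {C : Matrix ι ι 𝕜} (hC : C.PosDef) :
    ∑ j, logDist (A j) G ^ 2 ≤ ∑ j, logDist (A j) C ^ 2 := by
  simpa only [rdist_eq_logDist (hA _) hG.1, rdist_eq_logDist (hA _) hC] using hG.2 C hC

theorem isBlockWalk_inductiveMean (hA : ∀ i, (A i).PosDef) (hG : IsLeastSquaresMean A G)
    (σ : ℕ → Equiv.Perm (Fin m)) :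
    IsBlockWalk (fun i => PosDefCone.mk (A i) (hA i)) (PosDefCone.mk G hG.1)
      (fun n => PosDefCone.mk (blockSeq A σ n) (posDef_blockSeq hA σ n))
      (fun n => PosDefCone.mk (inductiveMean (blockSeq A σ) n)
        (posDef_inductiveMean (posDef_blockSeq hA σ) n))
      (diam A) where
  toIsWalk := isWalk_inductiveMean (posDef_blockSeq hA σ)
  block k f := by
    rw [Finset.sum_range, ← Equiv.sum_comp (σ k) fun i => f (PosDefCone.mk (A i) (hA i))]
    refine Finset.sum_congr rfl fun j _ => congrArg f (Subtype.ext ?_)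
    exact blockSeq_mul_add A σ k j
  mem n := ⟨_, rfl⟩
  diam i j := (dist_mk_mk _ _).trans_le (rdist_le_diam A i j)
  variance z := sum_logDist_sq_add_le hA hG.1 (fun _ hC => hG.sum_logDist_sq_le hA hC) z.2

theorem exists_isLeastSquaresMean (hA : ∀ i, (A i).PosDef) :
    ∃ G : Matrix ι ι 𝕜, IsLeastSquaresMean A G := by
  obtain ⟨G, hG, h⟩ := exists_isMin_sum_logDist_sq (NeZero.pos m) hA
  refine ⟨G, hG, fun C hC => ?_⟩
  simpa only [rdist_eq_logDist (hA _) hG, rdist_eq_logDist (hA _) hC] using h C hC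

theorem IsLeastSquaresMean.unique (hA : ∀ i, (A i).PosDef) (hG : IsLeastSquaresMean A G)
    {G' : Matrix ι ι 𝕜} (hG' : IsLeastSquaresMean A G') : G' = G := by
  have h1 := sum_logDist_sq_add_le hA hG.1 (fun _ hC => hG.sum_logDist_sq_le hA hC) hG'.1
  have h2 := hG'.sum_logDist_sq_le hA hG.1
  have hm : (0 : ℝ) < m := Nat.cast_pos.2 (NeZero.pos m)
  have h3 : m * logDist G G' ^ 2 ≤ 0 := by linarith
  have h4 : logDist G G' ^ 2 ≤ 0 := by
    by_contra! h
    exact absurd h3 (not_le.2 (mul_pos hm h))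
  exact (eq_of_logDist_eq_zero hG.1 hG'.1
    (pow_eq_zero_iff two_ne_zero |>.1 (le_antisymm h4 (sq_nonneg _)))).symm

theorem meanSqDist_eq (hA : ∀ i, (A i).PosDef) (hG : G.PosDef) :
    meanSqDist A G = 1 / (m : ℝ) *
      ∑ i, dist (PosDefCone.mk (A i) (hA i)) (PosDefCone.mk G hG) ^ 2 := by
  simp only [meanSqDist, dist_comm _ (PosDefCone.mk G hG), dist_mk_mk]

theorem rdist_inductiveMean_sq_le_div (hA : ∀ i, (A i).PosDef) (hG : IsLeastSquaresMean A G)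
    (σ : ℕ → Equiv.Perm (Fin m)) {n : ℕ} (hn : 1 ≤ n) :
    rdist (inductiveMean (blockSeq A σ) n) G ^ 2 ≤
      (4 * m * (meanSqDist A G + 2 * diam A ^ 2)) / n := by
  have h := (isBlockWalk_inductiveMean hA hG σ).dist_sq_le_div hn
  rwa [← meanSqDist_eq hA hG.1, dist_mk_mk] at h

theorem mul_rdist_inductiveMean_sq_le (hA : ∀ i, (A i).PosDef) (hG : IsLeastSquaresMean A G)
    (σ : ℕ → Equiv.Perm (Fin m)) {k : ℕ} (hk : 1 ≤ k) :
    k * rdist (inductiveMean (blockSeq A σ) (k * m)) G ^ 2 ≤ meanSqDist A G + diam A ^ 2 := by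
  have h := (isBlockWalk_inductiveMean hA hG σ).mul_dist_sq_le hk
  rwa [← meanSqDist_eq hA hG.1, dist_mk_mk] at h

theorem tendsto_inductiveMean (hA : ∀ i, (A i).PosDef) (hG : IsLeastSquaresMean A G)
    (σ : ℕ → Equiv.Perm (Fin m)) :
    Filter.Tendsto (fun n => inductiveMean (blockSeq A σ) n) Filter.atTop (nhds G) := by
  have hS : ∀ n, (inductiveMean (blockSeq A σ) n).PosDef := posDef_inductiveMean (posDef_blockSeq hA σ)
  refine tendsto_of_tendsto_logDist hG.1 hS ?_
  have h1 : Filter.Tendsto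
      (fun n : ℕ => √((4 * m * (meanSqDist A G + 2 * diam A ^ 2)) / n)) Filter.atTop (nhds 0) := by
    have := (tendsto_const_div_atTop_nhds_zero_nat
      (4 * m * (meanSqDist A G + 2 * diam A ^ 2))).sqrt
    rwa [Real.sqrt_zero] at this
  refine squeeze_zero' (Filter.Eventually.of_forall fun n => logDist_nonneg _ _) ?_ h1
  filter_upwards [Filter.eventually_ge_atTop 1] with n hn
  refine Real.le_sqrt_of_sq_le ?_
  rw [logDist_comm hG.1 (hS n), ← rdist_eq_logDist (hS n) hG.1]
  exact rdist_inductiveMean_sq_le_div hA hG σ hn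

end

end LSMean

end

open scoped ComplexOrder in
theorem theorem1p2 {𝕜 : Type*} [RCLike 𝕜] {ι : Type*} [Fintype ι] [DecidableEq ι]
    {m : ℕ} [NeZero m] (A : Fin m → Matrix ι ι 𝕜) (hA : ∀ i, (A i).PosDef) :
    ∃ G : Matrix ι ι 𝕜,
      -- `G` is the unique least squares mean of the given matrices
      LSMean.IsLeastSquaresMean A G ∧
      (∀ G' : Matrix ι ι 𝕜, LSMean.IsLeastSquaresMean A G' → G' = G) ∧
      -- the rate `L / n`, with `L` depending on the matrices only
      (∃ L : ℝ, 0 < L ∧ ∀ (σ : ℕ → Equiv.Perm (Fin m)) (n : ℕ), 1 ≤ n →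
        LSMean.rdist (LSMean.inductiveMean (LSMean.blockSeq A σ) n) G ^ 2 ≤ L / n) ∧
      -- convergence
      (∀ σ : ℕ → Equiv.Perm (Fin m),
        Filter.Tendsto (fun n => LSMean.inductiveMean (LSMean.blockSeq A σ) n)
          Filter.atTop (nhds G)) ∧
      -- the explicit constant along `n = k m`
      (∀ (σ : ℕ → Equiv.Perm (Fin m)) (k : ℕ), 1 ≤ k →
        LSMean.rdist (LSMean.inductiveMean (LSMean.blockSeq A σ) (k * m)) G ^ 2 ≤
          (LSMean.meanSqDist A G + 3 * LSMean.diam A ^ 2) / k) := by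
  obtain ⟨G, hG⟩ := LSMean.exists_isLeastSquaresMean hA
  have hα : 0 ≤ LSMean.meanSqDist A G :=
    mul_nonneg (by positivity) (Finset.sum_nonneg fun _ _ => sq_nonneg _)
  -- The added 1 keeps L positive when all the matrices coincide.
  refine ⟨G, hG, fun G' hG' => hG.unique hA hG',
    ⟨4 * m * (LSMean.meanSqDist A G + 2 * LSMean.diam A ^ 2) + 1, by positivity,
      fun σ n hn => ?_⟩, LSMean.tendsto_inductiveMean hA hG, fun σ k hk => ?_⟩
  · refine (LSMean.rdist_inductiveMean_sq_le_div hA hG σ hn).trans ?_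
    gcongr
    exact le_add_of_nonneg_right zero_le_one
  · have hk0 : (0 : ℝ) < k := Nat.cast_pos.2 hk
    rw [le_div_iff₀ hk0]
    have h := LSMean.mul_rdist_inductiveMean_sq_le hA hG σ hk
    nlinarith [sq_nonneg (LSMean.diam A)]
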